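/- Let $E$ be a complex Hilbert space, $\hbar>0$, and let $\hat H$ be a densely defined symmetric operator in $E$ with closure $\overline{H}$ and adjoint $\hat H^*$. Put $\mathrm{Ker}(i\pm\hat H^*)=\{\Psi\in D(\hat H^*):\hat H^*\Psi=\mp i\Psi\}$, with the norm of $E$. For a linear contraction $T:\mathrm{Ker}(i+\hat H^*)\to\mathrm{Ker}(i-\hat H^*)$ let $\hat H_T$ be the restriction of $\hat H^*$ to $$D(\hat H_T)=\{\Psi=\Psi_0+\Psi_++\Psi_-\in D(\hat H^*):\ \Psi_0\in D(\overline{H}),\ \Psi_\pm\in\mathrm{Ker}(i\mp\hat H^*),\ \Psi_+=T\Psi_-\}.$$ A $C_0$ contraction semigroup on $E$ is a family $(U(t))_{t\ge0}$ of linear maps of $E$ with $U(0)=1$, $U(t+s)=U(t)U(s)$, $\|U(t)\Psi\|\le\|\Psi\|$, and $t\mapsto U(t)\Psi$ norm-continuous for every $\Psi$; its generator is $B\Psi=\lim_{t\to0^+}(U(t)\Psi-\Psi)/t$, with domain the set of all $\Psi$ for which the limit exists. An operator $B$ is dissipative if $\mathrm{Re}\langle B\Psi,\Psi\rangle\le0$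 on $D(B)$, and maximally dissipative if moreover it has no proper dissipative extension. (a) For every linear contraction $T:\mathrm{Ker}(i+\hat H^*)\to\mathrm{Ker}(i-\hat H^*)$ the operator $\frac{-i}{\hbar}\hat H_T$ is a densely defined, maximally dissipative extension of $\frac{-i}{\hbar}\hat H$, and it is the generator of exactly one $C_0$ contraction semigroup. (b) Let $T_\epsilon$ ($\epsilon>0$) and $T_0$ be linear contractions $\mathrm{Ker}(i+\hat H^*)\to\mathrm{Ker}(i-\hat H^*)$, and for $\epsilon>0$ let $U_\epsilon$ be the $C_0$ contraction semigroup with generator $\frac{-i}{\hbar}\hat H_{T_\epsilon}$. If $T_\epsilon\to T_0$ strongly (in particular, if $T_\epsilon\to T_0$ in operator norm) as $\epsilon\to0^+$, then there is a $C_0$ contraction semigroup $U_0$ such that $\lim_{\epsilon\to0^+}U_\epsilon(t)\Psi=U_0(t)\Psi$ for all $t\ge0$ and $\Psi\in E$, and $U_0$ is generated by the maximally dissipative operator $\frac{-i}{\hbar}\hat H_{T_0}$. (c) All this applies to the Hamiltonian of a photon between two electrons of mass $m_e\ge0$ in one space dimension: let $\mathcal S_1=\{(s_{0},s_{1},s_{2})\in\mathbb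 R^3: s_{1}<s_{0}<s_{2}\}$ (photon, first electron, second electron), $\gamma^0=\begin{pmatrix}0&1\\1&0\end{pmatrix}$, $\gamma^1=\begin{pmatrix}0&-1\\1&0\end{pmatrix}$. Then the operator $$\hat H=\sum_{j=0}^{2}\big(m_j\gamma^0_{(j)}-i\hbar\,\gamma^0_{(j)}\gamma^1_{(j)}\partial_{s_j}\big),\qquad m_0=0,\ m_1=m_2=m_e,\qquad D(\hat H)=C_c^\infty(\mathcal S_1,\mathbb C^8),$$ in $L^2(\mathcal S_1,\mathbb C^8)$, where $\mathbb C^8=\mathbb C^2\otimes\mathbb C^2\otimes\mathbb C^2$ and the index $(j)$ means action on the $j$-th tensor factor (numbered $0,1,2$), is densely defined and symmetric. -/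

import Mathlib

open MeasureTheory Filter Topology
open scoped NNReal ContDiff InnerProductSpace Kronecker

/-! ### Contraction semigroups and dissipative operators on a Hilbert space -/

section Abstract

variable {E : Type*} [NormedAddCommGroup E] [InnerProductSpace ℂ E]

variable (E) in
/-- A `C₀` contraction semigroup on `E`. -/
@[ext]
structure C0ContractionSemigroup where
  /-- The operator at time `t ≥ 0`. -/
  op : ℝ≥0 → E →L[ℂ] E
  op_zero : op 0 = ContinuousLinearMap.id ℂ E
  op_add : ∀ t s, op (t + s) = (op t).comp (op s)
  strongly_continuous : ∀ x, Continuous fun t => op t x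
  contraction : ∀ t x, ‖op t x‖ ≤ ‖x‖

/-- `B` is the infinitesimal generator of `U`: the domain of `B` consists of exactly those `x` for
which `(U(t) x - x) / t` converges in norm as `t → 0⁺`, and `B x` is the limit. -/
def C0ContractionSemigroup.IsGeneratedBy (U : C0ContractionSemigroup E) (B : E →ₗ.[ℂ] E) : Prop :=
  ∀ x y : E, (x, y) ∈ B.graph ↔
    Tendsto (fun t : ℝ≥0 => (t : ℝ)⁻¹ • (U.op t x - x)) (𝓝[>] 0) (𝓝 y)

/-- `Re ⟨B x, x⟩ ≤ 0` on the domain of `B`. -/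
def IsDissipative (B : E →ₗ.[ℂ] E) : Prop :=
  ∀ x : B.domain, (⟪B x, (x : E)⟫_ℂ).re ≤ 0

/-- A dissipative operator without proper dissipative extensions. -/
def IsMaximallyDissipative (B : E →ₗ.[ℂ] E) : Prop :=
  IsDissipative B ∧ ∀ A : E →ₗ.[ℂ] E, IsDissipative A → B ≤ A → A = B

variable [CompleteSpace E]

/-- The eigenspace `{x ∈ D(H*) : H* x = z x}` of the adjoint of `H`. -/
noncomputable def adjointEigenspace (H : E →ₗ.[ℂ] E) (z : ℂ) : Submodule ℂ E :=
  H.adjoint.graph.comap (LinearMap.id.prod (z • LinearMap.id))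

theorem mem_adjointEigenspace_iff (H : E →ₗ.[ℂ] E) (z : ℂ) (x : E) :
    x ∈ adjointEigenspace H z ↔ ∃ h : x ∈ H.adjoint.domain, H.adjoint ⟨x, h⟩ = z • x := by
  simp only [adjointEigenspace, Submodule.mem_comap, LinearMap.prod_apply, Function.prod_apply,
    LinearMap.id_apply, LinearMap.smul_apply, LinearPMap.mem_graph_iff, Subtype.exists]
  constructor
  · rintro ⟨a, ha, rfl, h⟩
    exact ⟨ha, h⟩
  · rintro ⟨h, h'⟩
    exact ⟨x, h, rfl, h'⟩

/-- `Ker (i - H*)`, i.e. `H* x = i x`. -/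
noncomputable abbrev kerPlus (H : E →ₗ.[ℂ] E) : Submodule ℂ E := adjointEigenspace H Complex.I

/-- `Ker (i + H*)`, i.e. `H* x = -i x`. -/
noncomputable abbrev kerMinus (H : E →ₗ.[ℂ] E) : Submodule ℂ E := adjointEigenspace H (-Complex.I)

/-- The subspace of vectors `x₀ + x₊ + x₋` with `x₀` in the domain of the closure of `H`,
`x₋ ∈ Ker (i + H*)` and `x₊ = T x₋ ∈ Ker (i - H*)`. -/
noncomputable def extensionSubspace (H : E →ₗ.[ℂ] E) (T : kerMinus H →L[ℂ] kerPlus H) :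
    Submodule ℂ E :=
  H.closure.domain ⊔ LinearMap.range ((kerPlus H).subtype ∘ₗ T.toLinearMap + (kerMinus H).subtype)

theorem mem_extensionSubspace_iff (H : E →ₗ.[ℂ] E) (T : kerMinus H →L[ℂ] kerPlus H) (x : E) :
    x ∈ extensionSubspace H T ↔ ∃ x₀ ∈ H.closure.domain, ∃ (xp : kerPlus H) (xm : kerMinus H),
      x = x₀ + xp + xm ∧ xp = T xm := by
  simp only [extensionSubspace, Submodule.mem_sup, LinearMap.mem_range]
  constructor
  · rintro ⟨x₀, h₀, _, ⟨xm, rfl⟩, rfl⟩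
    exact ⟨x₀, h₀, T xm, xm, by simp [add_assoc], rfl⟩
  · rintro ⟨x₀, h₀, xp, xm, rfl, rfl⟩
    exact ⟨x₀, h₀, _, ⟨xm, rfl⟩, by simp [add_assoc]⟩

/-- The restriction `H_T` of `H*` to `{x₀ + x₊ + x₋ ∈ D(H*) : x₊ = T x₋}`. -/
noncomputable def extensionOf (H : E →ₗ.[ℂ] E) (T : kerMinus H →L[ℂ] kerPlus H) : E →ₗ.[ℂ] E :=
  H.adjoint.domRestrict (extensionSubspace H T)

/-- The operator `(-i / ħ) H`. -/
noncomputable def evolutionOperator (ħ : ℝ) (H : E →ₗ.[ℂ] E) : E →ₗ.[ℂ] E :=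
  (-Complex.I / (ħ : ℂ)) • H

end Abstract

/-! ### The Hamiltonian of the electron-photon-electron system -/

namespace ThreeBody

/-- The configurations `(s_ph, s_e₁, s_e₂)`, with coordinates `0, 1, 2` in this order. -/
abbrev Config : Type := EuclideanSpace ℝ (Fin 3)

/-- `ℂ² ⊗ ℂ² ⊗ ℂ²`, with components `ψ_{ς₀ ς₁ ς₂}`; the index `0` stands for the sign `-` and the
index `1` for the sign `+`. -/
abbrev Spinor : Type := EuclideanSpace ℂ (Fin 2 × Fin 2 × Fin 2)

/-- The configurations with `s_e₁ < s_ph < s_e₂`. -/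
def S₁ : Set Config := {x | x 1 < x 0 ∧ x 0 < x 2}

/-- `L²(S₁, ℂ⁸)`. -/
abbrev L2 : Type := Lp Spinor 2 ((volume : Measure Config).restrict S₁)

/-- The matrix `γ⁰`. -/
def γ0 : Matrix (Fin 2) (Fin 2) ℂ := !![0, 1; 1, 0]

/-- The matrix `γ¹`. -/
def γ1 : Matrix (Fin 2) (Fin 2) ℂ := !![0, -1; 1, 0]

/-- `A ⊗ 1 ⊗ 1`, `1 ⊗ A ⊗ 1`, `1 ⊗ 1 ⊗ A` for `j = 0, 1, 2`. -/
def onFactor (j : Fin 3) (A : Matrix (Fin 2) (Fin 2) ℂ) :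
    Matrix (Fin 2 × Fin 2 × Fin 2) (Fin 2 × Fin 2 × Fin 2) ℂ :=
  ![A ⊗ₖ ((1 : Matrix (Fin 2) (Fin 2) ℂ) ⊗ₖ (1 : Matrix (Fin 2) (Fin 2) ℂ)),
    (1 : Matrix (Fin 2) (Fin 2) ℂ) ⊗ₖ (A ⊗ₖ (1 : Matrix (Fin 2) (Fin 2) ℂ)),
    (1 : Matrix (Fin 2) (Fin 2) ℂ) ⊗ₖ ((1 : Matrix (Fin 2) (Fin 2) ℂ) ⊗ₖ A)] j

/-- The masses of the photon and of the two electrons. -/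
def mass (m : ℝ) : Fin 3 → ℝ := ![0, m, m]

/-- The differential expression `∑ⱼ (mⱼ γ⁰ - i ħ γ⁰ γ¹ ∂ⱼ)`, the `j`-th summand acting on the `j`-th
tensor factor. -/
noncomputable def hamiltonianExpr (ħ m : ℝ) (f : Config → Spinor) (x : Config) : Spinor :=
  ∑ j : Fin 3,
    ((mass m j : ℂ) • Matrix.toEuclideanCLM (𝕜 := ℂ) (onFactor j γ0) (f x) -
      (Complex.I * ħ) • Matrix.toEuclideanCLM (𝕜 := ℂ) (onFactor j (γ0 * γ1))
        (fderiv ℝ f x (EuclideanSpace.single j 1)))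

/-- `C_c^∞(S₁, ℂ⁸)`, as functions on the whole space. -/
def testFunctions : Submodule ℂ (Config → Spinor) where
  carrier := {f | ContDiff ℝ ∞ f ∧ HasCompactSupport f ∧ tsupport f ⊆ S₁}
  zero_mem' := ⟨contDiff_const, HasCompactSupport.zero, by simp [tsupport]⟩
  add_mem' := by
    rintro f g ⟨hf, hfc, hfs⟩ ⟨hg, hgc, hgs⟩
    exact ⟨hf.add hg, hfc.add hgc, (tsupport_add f g).trans (Set.union_subset hfs hgs)⟩
  smul_mem' := by
    rintro c f ⟨hf, hfc, hfs⟩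
    exact ⟨contDiff_const.smul hf, hfc.smul_left (f := fun _ => c),
      (tsupport_smul_subset_right (fun _ => c) f).trans hfs⟩

theorem tsupport_hamiltonianExpr (ħ m : ℝ) (f : Config → Spinor) :
    tsupport (hamiltonianExpr ħ m f) ⊆ tsupport f := by
  refine closure_minimal (fun x hx => ?_) (isClosed_tsupport f)
  by_contra h
  apply hx
  have h1 : f x = 0 := image_eq_zero_of_notMem_tsupport h
  have h2 : fderiv ℝ f x = 0 :=
    image_eq_zero_of_notMem_tsupport fun h' => h (tsupport_fderiv_subset ℝ h')
  simp [hamiltonianExpr, h1, h2]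

/-- The differential expression on `C_c^∞(S₁, ℂ⁸)`. -/
noncomputable def hamiltonianTest (ħ m : ℝ) : testFunctions →ₗ[ℂ] testFunctions where
  toFun f := ⟨hamiltonianExpr ħ m f, by
    obtain ⟨f, hf, hfc, hfs⟩ := f
    refine ⟨?_, ?_, (tsupport_hamiltonianExpr ħ m f).trans hfs⟩
    · have hd : ContDiff ℝ ∞ (fderiv ℝ f) := hf.fderiv_right (by simp)
      refine ContDiff.sum fun j _ => ?_
      refine ContDiff.sub (ContDiff.const_smul _ ?_) (ContDiff.const_smul _ ?_)
      · exact ((Matrix.toEuclideanCLM (𝕜 := ℂ) (onFactor j γ0)).restrictScalars ℝ).contDiff.comp hf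
      · exact ((Matrix.toEuclideanCLM (𝕜 := ℂ)
          (onFactor j (γ0 * γ1))).restrictScalars ℝ).contDiff.comp (hd.clm_apply contDiff_const)
    · exact hfc.of_isClosed_subset (isClosed_tsupport _) (tsupport_hamiltonianExpr ħ m f)⟩
  map_add' := by
    rintro ⟨f, hf, hfc, hfs⟩ ⟨g, hg, hgc, hgs⟩
    ext1
    funext x
    have h : fderiv ℝ (f + g) x = fderiv ℝ f x + fderiv ℝ g x :=
      fderiv_add (hf.differentiable (by simp) x) (hg.differentiable (by simp) x)
    simp only [hamiltonianExpr, Submodule.coe_add, Pi.add_apply, h, ← Finset.sum_add_distrib,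
      add_apply, map_add, smul_add]
    exact Finset.sum_congr rfl fun j _ => by abel
  map_smul' := by
    rintro c ⟨f, hf, hfc, hfs⟩
    ext1
    funext x
    have h : fderiv ℝ (c • f) x = c • fderiv ℝ f x :=
      fderiv_const_smul (hf.differentiable (by simp) x) c
    simp only [hamiltonianExpr, Submodule.coe_smul, Pi.smul_apply, h, Finset.smul_sum,
      smul_apply, map_smul, smul_sub, RingHom.id_apply]
    exact Finset.sum_congr rfl fun j _ => by
      rw [smul_comm c, smul_comm c]

theorem isOpen_S₁ : IsOpen S₁ :=
  (isOpen_lt (f := fun x : Config => x 1) (g := fun x : Config => x 0)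
    (by fun_prop) (by fun_prop)).inter
  (isOpen_lt (f := fun x : Config => x 0) (g := fun x : Config => x 2)
    (by fun_prop) (by fun_prop))

theorem memLp_testFunction (f : testFunctions) :
    MemLp (f : Config → Spinor) 2 ((volume : Measure Config).restrict S₁) :=
  (f.2.1.continuous.memLp_of_hasCompactSupport f.2.2.1).restrict S₁

/-- The embedding of `C_c^∞(S₁, ℂ⁸)` into `L²(S₁, ℂ⁸)`. -/
noncomputable def testToL2 : testFunctions →ₗ[ℂ] L2 where
  toFun f := (memLp_testFunction f).toLp f
  map_add' f g := MemLp.toLp_add (memLp_testFunction f) (memLp_testFunction g)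
  map_smul' c f := MemLp.toLp_const_smul c (memLp_testFunction f)

theorem testToL2_injective : Function.Injective testToL2 := by
  rw [← LinearMap.ker_eq_bot, LinearMap.ker_eq_bot']
  intro f hf
  have h0 : (f : Config → Spinor) =ᵐ[(volume : Measure Config).restrict S₁] 0 := by
    have := (memLp_testFunction f).coeFn_toLp
    have h1 : MemLp.toLp (f : Config → Spinor) (memLp_testFunction f) = 0 := hf
    rw [h1] at this
    exact this.symm.trans (Lp.coeFn_zero _ _ _)
  have h1 : Set.EqOn (f : Config → Spinor) 0 S₁ :=
    Measure.eqOn_open_of_ae_eq h0 isOpen_S₁ f.2.1.continuous.continuousOn continuousOn_const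
  ext1
  funext x
  by_cases hx : x ∈ S₁
  · exact h1 hx
  · exact image_eq_zero_of_notMem_tsupport fun h => hx (f.2.2.2 h)

/-- The Hamiltonian `Ĥ` of the electron-photon-electron system, as an operator in `L²(S₁, ℂ⁸)` with
domain `C_c^∞(S₁, ℂ⁸)`; `m` is the mass of the electrons. -/
noncomputable def hamiltonian (ħ m : ℝ) : L2 →ₗ.[ℂ] L2 where
  domain := LinearMap.range testToL2
  toFun := testToL2 ∘ₗ hamiltonianTest ħ m ∘ₗ
    (LinearEquiv.ofInjective testToL2 testToL2_injective).symm.toLinearMap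

theorem hamiltonian_apply_testToL2 (ħ m : ℝ) (f : testFunctions)
    (h : testToL2 f ∈ (hamiltonian ħ m).domain) :
    hamiltonian ħ m ⟨testToL2 f, h⟩ = testToL2 (hamiltonianTest ħ m f) := by
  have : (LinearEquiv.ofInjective testToL2 testToL2_injective).symm ⟨testToL2 f, h⟩ = f := by
    rw [LinearEquiv.symm_apply_eq]
    rfl
  change testToL2 (hamiltonianTest ħ m
    ((LinearEquiv.ofInjective testToL2 testToL2_injective).symm ⟨testToL2 f, h⟩)) = _
  rw [this]

theorem inner_testToL2 (f g : testFunctions) :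
    ⟪testToL2 f, testToL2 g⟫_ℂ =
      ∫ x, ⟪(f : Config → Spinor) x, (g : Config → Spinor) x⟫_ℂ := by
  rw [L2.inner_def, ← setIntegral_eq_integral_of_forall_compl_eq_zero (s := S₁)
    (f := fun x => ⟪(f : Config → Spinor) x, (g : Config → Spinor) x⟫_ℂ)]
  · refine integral_congr_ae ?_
    filter_upwards [(memLp_testFunction f).coeFn_toLp, (memLp_testFunction g).coeFn_toLp]
      with x hf hg
    change ⟪MemLp.toLp (f : Config → Spinor) (memLp_testFunction f) x,
      MemLp.toLp (g : Config → Spinor) (memLp_testFunction g) x⟫_ℂ = _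
    rw [hf, hg]
  · intro x hx
    have : (f : Config → Spinor) x = 0 :=
      image_eq_zero_of_notMem_tsupport fun h => hx (f.2.2.2 h)
    rw [this, inner_zero_left]

/-- `C_c^∞(S₁, ℂ⁸)` is dense in `L²(S₁, ℂ⁸)`. -/
theorem hamiltonian_dense (ħ m : ℝ) : Dense ((hamiltonian ħ m).domain : Set L2) := by
  change Dense ((LinearMap.range testToL2 : Submodule ℂ L2) : Set L2)
  rw [Submodule.dense_iff_topologicalClosure_eq_top, Submodule.topologicalClosure_eq_top_iff,
    Submodule.eq_bot_iff]
  intro u hu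
  rw [Submodule.mem_orthogonal] at hu
  have huL : MemLp u 2 ((volume : Measure Config).restrict S₁) := Lp.memLp u
  have hloc : LocallyIntegrableOn u S₁ (volume : Measure Config) :=
    locallyIntegrableOn_of_locallyIntegrable_restrict (huL.locallyIntegrable (by norm_num))
  have hloc' : LocallyIntegrable u ((volume : Measure Config).restrict S₁) :=
    huL.locallyIntegrable (by norm_num)
  have key := isOpen_S₁.ae_eq_zero_of_integral_contDiff_smul_eq_zero hloc (fun g hg hgc hgs => by
    have hint : Integrable (fun x => g x • u x) ((volume : Measure Config).restrict S₁) :=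
      hloc'.integrable_smul_left_of_hasCompactSupport hg.continuous hgc
    rw [← setIntegral_eq_integral_of_forall_compl_eq_zero (s := S₁) (f := fun x => g x • u x)]
    swap
    · intro x hx
      have : g x = 0 := image_eq_zero_of_notMem_tsupport fun h => hx (hgs h)
      rw [this, zero_smul]
    refine ext_inner_left ℂ fun v => ?_
    rw [← integral_inner hint, inner_zero_right]
    let f : testFunctions := ⟨fun x => g x • v, hg.smul contDiff_const,
      hgc.smul_right (f' := fun _ => v),
      (tsupport_smul_subset_left g (fun _ => v)).trans hgs⟩
    have h := hu (testToL2 f) ⟨f, rfl⟩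
    rw [L2.inner_def] at h
    rw [← h]
    refine integral_congr_ae ?_
    filter_upwards [(memLp_testFunction f).coeFn_toLp] with x hx
    change _ = ⟪MemLp.toLp (f : Config → Spinor) (memLp_testFunction f) x, _⟫_ℂ
    rw [hx]
    change _ = ⟪g x • v, u x⟫_ℂ
    rw [RCLike.real_smul_eq_coe_smul (K := ℂ), RCLike.real_smul_eq_coe_smul (K := ℂ) (g x) v,
      inner_smul_right, inner_smul_left, RCLike.conj_ofReal])
  refine (Lp.eq_zero_iff_ae_eq_zero).2 ?_
  exact (ae_restrict_iff' isOpen_S₁.measurableSet).2 key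

theorem isHermitian_onFactor (j : Fin 3) {A : Matrix (Fin 2) (Fin 2) ℂ} (hA : A.IsHermitian) :
    (onFactor j A).IsHermitian := by
  have h : A.conjTranspose = A := hA
  unfold Matrix.IsHermitian
  fin_cases j <;> simp [onFactor, Matrix.conjTranspose_kronecker, h]

theorem inner_onFactor (j : Fin 3) {A : Matrix (Fin 2) (Fin 2) ℂ} (hA : A.IsHermitian)
    (v w : Spinor) :
    ⟪Matrix.toEuclideanCLM (𝕜 := ℂ) (onFactor j A) v, w⟫_ℂ =
      ⟪v, Matrix.toEuclideanCLM (𝕜 := ℂ) (onFactor j A) w⟫_ℂ := by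
  rw [← ContinuousLinearMap.adjoint_inner_right, ← ContinuousLinearMap.star_eq_adjoint, ← map_star,
    Matrix.star_eq_conjTranspose, (isHermitian_onFactor j hA).eq]

/-- `Ĥ` is symmetric. -/
theorem hamiltonian_symmetric (ħ m : ℝ) :
    (hamiltonian ħ m).IsFormalAdjoint (hamiltonian ħ m) := by
  rintro ⟨_, f, rfl⟩ ⟨_, g, rfl⟩
  erw [hamiltonian_apply_testToL2, hamiltonian_apply_testToL2]
  rw [inner_testToL2, inner_testToL2]
  obtain ⟨f, hf, hfc, hfs⟩ := f
  obtain ⟨g, hg, hgc, hgs⟩ := g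
  change ∫ x, ⟪hamiltonianExpr ħ m f x, g x⟫_ℂ = ∫ x, ⟪f x, hamiltonianExpr ħ m g x⟫_ℂ
  have hγ0 : γ0.IsHermitian := by
    ext i j
    fin_cases i <;> fin_cases j <;> simp [γ0]
  have hγ : (γ0 * γ1).IsHermitian := by
    ext i j
    fin_cases i <;> fin_cases j <;> simp [γ0, γ1]
  have hdf : ∀ v, Continuous fun x => fderiv ℝ f x v := fun v =>
    (hf.continuous_fderiv (by simp)).clm_apply continuous_const
  have hdg : ∀ v, Continuous fun x => fderiv ℝ g x v := fun v =>
    (hg.continuous_fderiv (by simp)).clm_apply continuous_const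
  have hcf := hf.continuous
  have hcg := hg.continuous
  have hz : ∀ x, x ∉ tsupport f → f x = 0 ∧ fderiv ℝ f x = 0 := fun x hx =>
    ⟨image_eq_zero_of_notMem_tsupport hx,
      image_eq_zero_of_notMem_tsupport fun h' => hx (tsupport_fderiv_subset ℝ h')⟩
  have hint : ∀ u w : Config → Spinor, Continuous u → Continuous w →
      (∀ x, x ∉ tsupport f → u x = 0) → Integrable fun x => ⟪u x, w x⟫_ℂ := by
    intro u w hu hw h0
    refine (hu.inner hw).integrable_of_hasCompactSupport (HasCompactSupport.intro hfc ?_)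
    intro x hx
    rw [h0 x hx, inner_zero_left]
  have hHf : Continuous (hamiltonianExpr ħ m f) :=
    (hamiltonianTest ħ m ⟨f, hf, hfc, hfs⟩).2.1.continuous
  have hHg : Continuous (hamiltonianExpr ħ m g) :=
    (hamiltonianTest ħ m ⟨g, hg, hgc, hgs⟩).2.1.continuous
  rw [← sub_eq_zero, ← integral_sub
    (hint _ _ hHf hcg fun x hx => by simp [hamiltonianExpr, hz x hx])
    (hint _ _ hcf hHg fun x hx => (hz x hx).1)]
  let M : Fin 3 → Spinor →L[ℂ] Spinor := fun j =>
    Matrix.toEuclideanCLM (𝕜 := ℂ) (onFactor j (γ0 * γ1))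
  let e : Fin 3 → Config := fun j => EuclideanSpace.single j 1
  have hpt : ∀ x, ⟪hamiltonianExpr ħ m f x, g x⟫_ℂ - ⟪f x, hamiltonianExpr ħ m g x⟫_ℂ =
      ∑ j, (Complex.I * ħ) * (⟪fderiv ℝ f x (e j), M j (g x)⟫_ℂ +
        ⟪f x, M j (fderiv ℝ g x (e j))⟫_ℂ) := by
    intro x
    simp only [hamiltonianExpr, sum_inner, inner_sum, ← Finset.sum_sub_distrib]
    refine Finset.sum_congr rfl fun j _ => ?_
    simp only [inner_sub_left, inner_sub_right, inner_smul_left, inner_smul_right,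
      inner_onFactor j hγ0, inner_onFactor j hγ, map_mul, Complex.conj_I, Complex.conj_ofReal, M, e]
    ring
  simp only [hpt]
  have hi1 : ∀ j, Integrable fun x => ⟪fderiv ℝ f x (e j), M j (g x)⟫_ℂ := fun j =>
    hint _ _ (hdf _) ((M j).continuous.comp hcg) fun x hx => by simp [hz x hx]
  have hi2 : ∀ j, Integrable fun x => ⟪f x, M j (fderiv ℝ g x (e j))⟫_ℂ := fun j =>
    hint _ _ hcf ((M j).continuous.comp (hdg _)) fun x hx => (hz x hx).1
  have hi3 : ∀ j, Integrable fun x => ⟪f x, M j (g x)⟫_ℂ := fun j =>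
    hint _ _ hcf ((M j).continuous.comp hcg) fun x hx => (hz x hx).1
  have hi4 : ∀ j, Integrable fun x => (Complex.I * ħ) * (⟪fderiv ℝ f x (e j), M j (g x)⟫_ℂ +
      ⟪f x, M j (fderiv ℝ g x (e j))⟫_ℂ) := fun j => ((hi1 j).add (hi2 j)).const_mul _
  rw [integral_finsetSum _ fun j _ => hi4 j]
  refine Finset.sum_eq_zero fun j _ => ?_
  rw [integral_const_mul, integral_add (hi1 j) (hi2 j)]
  have hB : IsBoundedBilinearMap ℝ fun p : Spinor × Spinor => ⟪p.1, p.2⟫_ℂ :=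
    isBoundedBilinearMap_inner
  have := integral_bilinear_hasFDerivAt_right_eq_neg_left_of_integrable (μ := volume)
    (f := f) (f' := fderiv ℝ f) (g := fun x => M j (g x))
    (g' := fun x => ((M j).restrictScalars ℝ).comp (fderiv ℝ g x)) (v := e j)
    (B := hB.toContinuousLinearMap) (hi1 j) (hi2 j) (hi3 j)
    (fun x _ => (hf.differentiable (by simp) x).hasFDerivAt)
    (fun x _ => ((M j).restrictScalars ℝ).hasFDerivAt.comp x
      (hg.differentiable (by simp) x).hasFDerivAt)
  have h2 : ∫ x, ⟪f x, M j (fderiv ℝ g x (e j))⟫_ℂ =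
      - ∫ x, ⟪fderiv ℝ f x (e j), M j (g x)⟫_ℂ := this
  rw [h2, add_neg_cancel, mul_zero]

end ThreeBody

/-! For `x = a + T m + m`, with `a` in the domain of the closure of `H` and `m` in `kerMinus H`, the
boundary form is `Im ⟨H_T x, x⟩ = ‖m‖² - ‖T m‖²`. So `B = (-i/ħ) H_T` is dissipative exactly because
`T` is a contraction (`isDissipative_extensionOf`). With `b = H̄ a`, one has `(1 - ħ B) x = (1 + i
H_T) x = a + i b + 2 m`, because `1 + i H*` kills `kerPlus H` and doubles `kerMinus H`. By symmetry
the range of `1 + i H̄` is closed, and its orthogonal complement lies in `kerMinus H`. Hence every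
`w` has the form `a + i b + 2 m` (`exists_decomposition`), and `1 - ħ B` is onto. This gives
maximality and the resolvent formula `R_T w = a + T m + m`. The decomposition of `w` does not
involve `T`, so strong convergence of the contractions is at once strong convergence of the
resolvents. What remains is general semigroup theory, carried by the resolvent alone. A firm `R`
with dense range yields bounded dissipative approximations of Yosida type of `1 - R⁻¹`. Their
exponentials converge to a contraction semigroup (`exists_semigroup`) whose generator is `1 - R⁻¹`
(`tendsto_quotient_iff`). The rate of convergence on the vectors `R (R y)` is uniform in `R`, which
gives a Trotter–Kato theorem (`tendsto_op`). A change of time scale by `1/ħ` returns from `ħ B` to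
`B`. -/

/-! ### Exponentials of bounded dissipative operators. -/

section BoundedDissipative

variable {E : Type*} [NormedAddCommGroup E] [InnerProductSpace ℂ E]

/-- A curve whose right derivative pairs dissipatively with it has nonincreasing norm. -/
theorem norm_le_of_hasDerivWithinAt_dissipative {f f' : ℝ → E} {b : ℝ}
    (hf : ContinuousOn f (Set.Icc 0 b))
    (hf' : ∀ t ∈ Set.Ico 0 b, HasDerivWithinAt f (f' t) (Set.Ici t) t)
    (hd : ∀ t ∈ Set.Ico 0 b, (⟪f' t, f t⟫_ℂ).re ≤ 0) {t : ℝ} (ht : t ∈ Set.Icc 0 b) :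
    ‖f t‖ ≤ ‖f 0‖ := by
  have hsq : ∀ x : E, (⟪x, x⟫_ℂ).re = ‖x‖ ^ 2 := fun x => by
    rw [inner_self_eq_norm_sq_to_K]; norm_cast
  have key : (⟪f t, f t⟫_ℂ).re ≤ (⟪f 0, f 0⟫_ℂ).re := by
    refine image_le_of_deriv_right_le_deriv_boundary
      (f := fun t => (⟪f t, f t⟫_ℂ).re) (f' := fun t => (⟪f t, f' t⟫_ℂ + ⟪f' t, f t⟫_ℂ).re)
      (B := fun _ => (⟪f 0, f 0⟫_ℂ).re) (B' := fun _ => 0) ?_ ?_ le_rfl continuousOn_const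
      (fun _ _ => hasDerivWithinAt_const _ _ _) ?_ ht
    · exact Complex.continuous_re.comp_continuousOn (hf.inner hf)
    · intro s hs
      exact Complex.reCLM.hasFDerivAt.comp_hasDerivWithinAt s ((hf' s hs).inner ℂ (hf' s hs))
    · intro s hs
      have h1 : (⟪f s, f' s⟫_ℂ).re = (⟪f' s, f s⟫_ℂ).re := inner_re_symm (𝕜 := ℂ) _ _
      rw [Complex.add_re, h1]
      linarith [hd s hs]
  rw [hsq, hsq] at key
  exact le_of_sq_le_sq key (norm_nonneg _)

theorem norm_pow_apply_le {A : E →L[ℂ] E} {C : ℝ} (hC : ‖A‖ ≤ C) (n : ℕ) (x : E) :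
    ‖(A ^ n) x‖ ≤ C ^ n * ‖x‖ := by
  induction n generalizing x with
  | zero => simp
  | succ n ih =>
    rw [pow_succ, pow_succ, mul_assoc]
    exact (ih (A x)).trans (mul_le_mul_of_nonneg_left (A.le_of_opNorm_le hC x)
      (pow_nonneg ((norm_nonneg A).trans hC) n))

variable [CompleteSpace E]

theorem hasDerivAt_exp_smul_apply (A : E →L[ℂ] E) (z : E) (t : ℝ) :
    HasDerivAt (fun u : ℝ => NormedSpace.exp (u • A) z) (NormedSpace.exp (t • A) (A z)) t :=
  (((ContinuousLinearMap.apply ℂ E z).restrictScalars ℝ).hasFDerivAt).comp_hasDerivAt t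
    (hasDerivAt_exp_smul_const A t)

theorem hasDerivAt_exp_smul_apply' (A : E →L[ℂ] E) (z : E) (t : ℝ) :
    HasDerivAt (fun u : ℝ => NormedSpace.exp (u • A) z) (A (NormedSpace.exp (t • A) z)) t :=
  (((ContinuousLinearMap.apply ℂ E z).restrictScalars ℝ).hasFDerivAt).comp_hasDerivAt t
    (hasDerivAt_exp_smul_const' A t)

variable {A A' : E →L[ℂ] E}

theorem norm_exp_smul_apply_le (hA : ∀ x, (⟪A x, x⟫_ℂ).re ≤ 0) {t : ℝ} (ht : 0 ≤ t) (x : E) :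
    ‖NormedSpace.exp (t • A) x‖ ≤ ‖x‖ := by
  have h := norm_le_of_hasDerivWithinAt_dissipative (b := t)
    (f := fun u : ℝ => NormedSpace.exp (u • A) x)
    (fun u _ => (hasDerivAt_exp_smul_apply' A x u).continuousAt.continuousWithinAt)
    (fun u _ => (hasDerivAt_exp_smul_apply' A x u).hasDerivWithinAt)
    (fun u _ => hA _) ⟨ht, le_rfl⟩
  simpa using h

/-- Interpolate by `u ↦ exp(uA) exp((t-u)A') z`. As `A` and `A'` commute, the derivative is two
contractions applied to `A z - A' z`, so the mean value inequality applies. -/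
theorem norm_exp_smul_sub_exp_smul_apply_le (hA : ∀ x, (⟪A x, x⟫_ℂ).re ≤ 0)
    (hA' : ∀ x, (⟪A' x, x⟫_ℂ).re ≤ 0) (hc : Commute A A') {t : ℝ} (ht : 0 ≤ t) (z : E) :
    ‖NormedSpace.exp (t • A) z - NormedSpace.exp (t • A') z‖ ≤ t * ‖A z - A' z‖ := by
  have hder : ∀ u : ℝ, HasDerivAt
      (fun u : ℝ => (NormedSpace.exp (u • A) * NormedSpace.exp ((t - u) • A')) z)
      (NormedSpace.exp (u • A) (NormedSpace.exp ((t - u) • A') (A z - A' z))) u := by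
    intro u
    have h1 := hasDerivAt_exp_smul_const A u
    have h2 : HasDerivAt (fun u : ℝ => NormedSpace.exp ((t - u) • A'))
        ((-1 : ℝ) • (NormedSpace.exp ((t - u) • A') * A')) u :=
      (hasDerivAt_exp_smul_const A' (t - u)).scomp u ((hasDerivAt_id u).const_sub t)
    have h3 := (((ContinuousLinearMap.apply ℂ E z).restrictScalars ℝ).hasFDerivAt).comp_hasDerivAt u
      (h1.mul h2)
    refine h3.congr_deriv ?_
    have hc' : A * NormedSpace.exp ((t - u) • A') = NormedSpace.exp ((t - u) • A') * A :=
      (hc.smul_right (t - u)).exp_right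
    change (NormedSpace.exp (u • A) * A * NormedSpace.exp ((t - u) • A') +
      NormedSpace.exp (u • A) * ((-1 : ℝ) • (NormedSpace.exp ((t - u) • A') * A'))) z = _
    rw [mul_assoc, hc']
    simp [sub_eq_add_neg]
  have h := norm_image_sub_le_of_norm_deriv_le_segment' (a := 0) (b := t) (C := ‖A z - A' z‖)
    (fun u _ => (hder u).hasDerivWithinAt)
    (fun u hu => (norm_exp_smul_apply_le hA hu.1 _).trans
      (norm_exp_smul_apply_le hA' (sub_nonneg.2 hu.2.le) _)) t ⟨ht, le_rfl⟩
  simpa [mul_comm] using h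

theorem norm_exp_smul_apply_sub_le (hA : ∀ x, (⟪A x, x⟫_ℂ).re ≤ 0) {t : ℝ} (ht : 0 ≤ t) (z : E) :
    ‖NormedSpace.exp (t • A) z - z‖ ≤ t * ‖A z‖ := by
  simpa using norm_exp_smul_sub_exp_smul_apply_le hA (A' := 0) (by simp) (Commute.zero_right A) ht z

/-- The derivative of `exp(uA) z - u A z` is `exp(uA) A z - A z`, bounded by `u ‖A (A z)‖` through
the first-order estimate. Replacing `u` by `t` loses only the factor `1/2`. -/
theorem norm_exp_smul_apply_sub_sub_le (hA : ∀ x, (⟪A x, x⟫_ℂ).re ≤ 0) {t : ℝ} (ht : 0 ≤ t)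
    (z : E) :
    ‖NormedSpace.exp (t • A) z - z - t • A z‖ ≤ t ^ 2 * ‖A (A z)‖ := by
  have h := norm_image_sub_le_of_norm_deriv_le_segment' (a := 0) (b := t) (C := t * ‖A (A z)‖)
    (f := fun u : ℝ => NormedSpace.exp (u • A) z - u • A z)
    (fun u _ => ((hasDerivAt_exp_smul_apply A z u).sub
      ((hasDerivAt_id u).smul_const (A z))).hasDerivWithinAt)
    (fun u hu => by
      rw [one_smul]
      exact (norm_exp_smul_apply_sub_le hA hu.1 _).trans
        (mul_le_mul_of_nonneg_right hu.2.le (norm_nonneg _))) t ⟨ht, le_rfl⟩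
  simp only [zero_smul, NormedSpace.exp_zero, sub_zero, one_apply_eq_self] at h
  rw [sub_right_comm]
  exact h.trans_eq (by ring)

/-- The exponential is continuous in the strong topology on norm-bounded sets. -/
theorem tendsto_exp_smul_apply {ι : Type*} {l : Filter ι} {A : ι → E →L[ℂ] E} {A₀ : E →L[ℂ] E}
    {C : ℝ} (hC : ∀ i, ‖A i‖ ≤ C) (h : ∀ x, Tendsto (fun i => A i x) l (𝓝 (A₀ x))) (t : ℝ) (x : E) :
    Tendsto (fun i => NormedSpace.exp (t • A i) x) l (𝓝 (NormedSpace.exp (t • A₀) x)) := by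
  have hexp : ∀ A : E →L[ℂ] E, NormedSpace.exp (t • A) x =
      ∑' n : ℕ, ((n.factorial : ℝ)⁻¹ * t ^ n) • (A ^ n) x := by
    intro A
    have h1 := (NormedSpace.exp_series_hasSum_exp' (𝕂 := ℝ) (t • A)).mapL
      ((ContinuousLinearMap.apply ℂ E x).restrictScalars ℝ)
    refine (h1.tsum_eq.symm.trans ?_ :)
    refine tsum_congr fun n => ?_
    simp [smul_pow, mul_smul]
  simp only [hexp]
  have hpow : ∀ n x, Tendsto (fun i => (A i ^ n) x) l (𝓝 ((A₀ ^ n) x)) := by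
    intro n
    induction n with
    | zero => intro x; simpa using tendsto_const_nhds
    | succ n ih =>
      intro x
      -- Telescoping: `Aᵢⁿ⁺¹ x = Aᵢⁿ (Aᵢ x - A₀ x) + Aᵢⁿ (A₀ x)`. The uniform norm bound controls
      -- the first term.
      have h0 : Tendsto (fun i => (A i ^ n) (A i x - A₀ x)) l (𝓝 0) := by
        refine squeeze_zero_norm (a := fun i => C ^ n * ‖A i x - A₀ x‖) (fun i => ?_) ?_
        · exact norm_pow_apply_le (hC i) n _
        · simpa using (tendsto_iff_norm_sub_tendsto_zero.1 (h x)).const_mul (C ^ n)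
      have := h0.add (ih (A₀ x))
      rw [zero_add] at this
      refine this.congr fun i => ?_
      simp [pow_succ]
  refine tendsto_tsum_of_dominated_convergence
    (bound := fun n => (|t| * C) ^ n / n.factorial * ‖x‖)
    ((Real.summable_pow_div_factorial _).mul_right _) (fun n => (hpow n x).const_smul _)
    (Eventually.of_forall fun i n => ?_)
  have h1 : ‖(A i ^ n) x‖ ≤ C ^ n * ‖x‖ := norm_pow_apply_le (hC i) n x
  rw [norm_smul, norm_mul, norm_inv, norm_pow, Real.norm_natCast, Real.norm_eq_abs]
  calc _ ≤ (n.factorial : ℝ)⁻¹ * |t| ^ n * (C ^ n * ‖x‖) := by gcongr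
    _ = _ := by rw [mul_pow]; ring

end BoundedDissipative

/-- An `ε/3` argument: nonexpansive maps, not necessarily linear, need to converge only on a dense
set. -/
theorem tendsto_of_denseRange_of_nonexpansive {E α ι : Type*} [NormedAddCommGroup E]
    {l : Filter ι} {F : ι → E → E} {F₀ : E → E} {G : α → E} (hG : DenseRange G)
    (hF : ∀ᶠ i in l, ∀ x y, ‖F i x - F i y‖ ≤ ‖x - y‖) (hF₀ : ∀ x y, ‖F₀ x - F₀ y‖ ≤ ‖x - y‖)
    (h : ∀ a, Tendsto (fun i => F i (G a)) l (𝓝 (F₀ (G a)))) (x : E) :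
    Tendsto (fun i => F i x) l (𝓝 (F₀ x)) := by
  rw [Metric.tendsto_nhds]
  intro ε hε
  obtain ⟨a, ha⟩ := hG.exists_dist_lt x (show 0 < ε / 3 by positivity)
  rw [dist_eq_norm] at ha
  filter_upwards [hF, Metric.tendsto_nhds.1 (h a) (ε / 3) (by positivity)] with i hi hi'
  rw [dist_eq_norm] at hi' ⊢
  have h1 := hi x (G a)
  have h2 := hF₀ (G a) x
  rw [norm_sub_rev (G a) x] at h2
  have h3 : F i x - F₀ x = (F i x - F i (G a)) + (F i (G a) - F₀ (G a)) + (F₀ (G a) - F₀ x) := by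
    abel
  rw [h3]
  refine (norm_add₃_le).trans_lt ?_
  linarith

/-! ### Contraction semigroups: dissipativity, uniqueness and time scaling. -/

section Semigroup

variable {E : Type*} [NormedAddCommGroup E] [InnerProductSpace ℂ E]

theorem C0ContractionSemigroup.norm_op_sub_le (U : C0ContractionSemigroup E) (t : ℝ≥0) (x y : E) :
    ‖U.op t x - U.op t y‖ ≤ ‖x - y‖ := by
  rw [← map_sub]
  exact U.contraction t _

/-- Each difference quotient is already dissipative, since `Re ⟨U(t) x, x⟩ ≤ ‖x‖²` by Cauchy–Schwarz
and contractivity. The inequality passes to the limit. -/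
theorem C0ContractionSemigroup.re_inner_le_zero (U : C0ContractionSemigroup E) {x y : E}
    (h : Tendsto (fun t : ℝ≥0 => (t : ℝ)⁻¹ • (U.op t x - x)) (𝓝[>] 0) (𝓝 y)) :
    (⟪y, x⟫_ℂ).re ≤ 0 := by
  refine le_of_tendsto (Complex.continuous_re.continuousAt.tendsto.comp
    (h.inner (𝕜 := ℂ) (tendsto_const_nhds (x := x)))) (Eventually.of_forall fun t => ?_)
  change (⟪(t : ℝ)⁻¹ • (U.op t x - x), x⟫_ℂ).re ≤ 0
  rw [RCLike.real_smul_eq_coe_smul (K := ℂ), inner_smul_real_left, inner_sub_left]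
  have h1 : (⟪U.op t x, x⟫_ℂ).re ≤ ‖x‖ ^ 2 := by
    refine (Complex.re_le_norm _).trans ((norm_inner_le_norm _ _).trans ?_)
    rw [sq]
    exact mul_le_mul_of_nonneg_right (U.contraction t x) (norm_nonneg _)
  have h2 : (⟪x, x⟫_ℂ).re = ‖x‖ ^ 2 := by
    rw [inner_self_eq_norm_sq_to_K]; norm_cast
  rw [Complex.smul_re, Complex.sub_re, h2]
  exact mul_nonpos_of_nonneg_of_nonpos (by positivity) (by linarith)

theorem C0ContractionSemigroup.hasDerivWithinAt (U : C0ContractionSemigroup E) {x y : E}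
    (h : Tendsto (fun t : ℝ≥0 => (t : ℝ)⁻¹ • (U.op t x - x)) (𝓝[>] 0) (𝓝 y)) {t : ℝ} (ht : 0 ≤ t) :
    HasDerivWithinAt (fun u : ℝ => U.op u.toNNReal x) (U.op t.toNNReal y) (Set.Ici t) t := by
  rw [hasDerivWithinAt_iff_tendsto_slope, Set.Ici_sdiff_left]
  have h1 : Tendsto (fun u : ℝ => (u - t).toNNReal) (𝓝[>] t) (𝓝[>] 0) := by
    refine tendsto_nhdsWithin_of_tendsto_nhds_of_eventually_within _ ?_
      (eventually_nhdsWithin_of_forall fun u (hu : t < u) => ?_)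
    · refine Tendsto.mono_left ?_ nhdsWithin_le_nhds
      exact Continuous.tendsto' (by fun_prop) _ _ (by simp)
    · simpa using hu
  refine ((((U.op t.toNNReal).continuous.tendsto y).comp (h.comp h1))).congr' ?_
  refine eventually_nhdsWithin_of_forall fun u (hu : t < u) => ?_
  have h2 : u.toNNReal = t.toNNReal + (u - t).toNNReal := by
    rw [← Real.toNNReal_add ht (by linarith)]; congr 1; ring
  simp only [Function.comp, slope_def_module]
  rw [h2, U.op_add, Real.coe_toNNReal _ (by linarith), RCLike.real_smul_eq_coe_smul (K := ℂ), map_smul,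
    RCLike.real_smul_eq_coe_smul (K := ℂ), map_sub]
  rfl

/-- The generator commutes with the semigroup. -/
theorem C0ContractionSemigroup.tendsto_op_apply (U : C0ContractionSemigroup E) {x y : E}
    (h : Tendsto (fun t : ℝ≥0 => (t : ℝ)⁻¹ • (U.op t x - x)) (𝓝[>] 0) (𝓝 y)) (s : ℝ≥0) :
    Tendsto (fun t : ℝ≥0 => (t : ℝ)⁻¹ • (U.op t (U.op s x) - U.op s x)) (𝓝[>] 0)
      (𝓝 (U.op s y)) := by
  refine (((U.op s).continuous.tendsto y).comp h).congr fun t => ?_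
  have h1 : U.op t (U.op s x) = U.op s (U.op t x) := by
    have := U.op_add t s
    rw [add_comm, U.op_add] at this
    exact (congrArg (fun f : E →L[ℂ] E => f x) this).symm
  simp only [Function.comp]
  rw [h1, RCLike.real_smul_eq_coe_smul (K := ℂ), RCLike.real_smul_eq_coe_smul (K := ℂ), map_smul,
    map_sub]

/-- A contraction semigroup is determined by its generator. -/
theorem C0ContractionSemigroup.IsGeneratedBy.unique {U V : C0ContractionSemigroup E}
    {B : E →ₗ.[ℂ] E} (hU : U.IsGeneratedBy B) (hV : V.IsGeneratedBy B)
    (hB : Dense (B.domain : Set E)) : U = V := by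
  have key : ∀ x ∈ B.domain, ∀ t, U.op t x = V.op t x := by
    intro x hx t
    have hg : (x, B ⟨x, hx⟩) ∈ B.graph := B.mem_graph ⟨x, hx⟩
    have hx1 := (hU x _).1 hg
    have hx2 := (hV x _).1 hg
    have h := norm_le_of_hasDerivWithinAt_dissipative (b := t) (t := t)
      (f := fun u : ℝ => U.op u.toNNReal x - V.op u.toNNReal x)
      (((U.strongly_continuous x).comp continuous_real_toNNReal).sub
        ((V.strongly_continuous x).comp continuous_real_toNNReal)).continuousOn
      (fun u hu => (U.hasDerivWithinAt hx1 hu.1).sub (V.hasDerivWithinAt hx2 hu.1))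
      -- Both generators are `B`, so the difference of the orbits and its right derivative form a
      -- pair in the graph of `B`. Dissipativity then keeps the norm of the difference at its
      -- initial value zero.
      (fun u hu => by
        refine U.re_inner_le_zero ((hU _ _).1 ?_)
        exact B.graph.sub_mem ((hU _ _).2 (U.tendsto_op_apply hx1 _))
          ((hV _ _).2 (V.tendsto_op_apply hx2 _))) ⟨t.2, le_rfl⟩
    simp only [Real.toNNReal_coe, Real.toNNReal_zero, U.op_zero, V.op_zero, sub_self,
      norm_zero] at h
    exact sub_eq_zero.1 (norm_le_zero_iff.1 h)
  ext t x
  have : (U.op t : E → E) = V.op t :=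
    (U.op t).continuous.ext_on hB (V.op t).continuous fun x hx => key x hx t
  exact congrFun this x

/-- The semigroup `t ↦ U (c t)`. -/
def C0ContractionSemigroup.rescale (U : C0ContractionSemigroup E) (c : ℝ≥0) :
    C0ContractionSemigroup E where
  op t := U.op (c * t)
  op_zero := by rw [mul_zero, U.op_zero]
  op_add t s := by rw [mul_add, U.op_add]
  strongly_continuous x := (U.strongly_continuous x).comp (continuous_const.mul continuous_id)
  contraction t x := U.contraction _ x

theorem C0ContractionSemigroup.tendsto_rescale_iff (U : C0ContractionSemigroup E) {c : ℝ≥0}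
    (hc : 0 < c) (x y : E) :
    Tendsto (fun t : ℝ≥0 => (t : ℝ)⁻¹ • ((U.rescale c).op t x - x)) (𝓝[>] 0) (𝓝 y) ↔
      Tendsto (fun t : ℝ≥0 => (t : ℝ)⁻¹ • (U.op t x - x)) (𝓝[>] 0) (𝓝 ((c : ℝ)⁻¹ • y)) := by
  have scale : ∀ a : ℝ≥0, 0 < a → Tendsto (fun t : ℝ≥0 => a * t) (𝓝[>] 0) (𝓝[>] 0) := fun a ha =>
    tendsto_nhdsWithin_of_tendsto_nhds_of_eventually_within _
      ((Continuous.tendsto' (by fun_prop) _ _ (mul_zero a)).mono_left nhdsWithin_le_nhds)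
      (eventually_nhdsWithin_of_forall fun t (ht : 0 < t) => mul_pos ha ht)
  have hc' : (c : ℝ) ≠ 0 := NNReal.coe_ne_zero.2 hc.ne'
  symm
  constructor
  · intro h
    have h1 := (h.comp (scale c hc)).const_smul (c : ℝ)
    rw [smul_inv_smul₀ hc'] at h1
    refine h1.congr fun t => ?_
    simp only [Function.comp, C0ContractionSemigroup.rescale, smul_smul]
    congr 1
    push_cast
    rw [mul_inv, mul_inv_cancel_left₀ hc']
  · intro h
    have h1 := (h.comp (scale c⁻¹ (inv_pos.2 hc))).const_smul (c : ℝ)⁻¹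
    refine h1.congr fun t => ?_
    simp only [Function.comp, C0ContractionSemigroup.rescale, smul_smul]
    rw [mul_inv_cancel_left₀ hc.ne']
    congr 1
    push_cast
    rw [mul_inv, inv_inv, inv_mul_cancel_left₀ hc']

end Semigroup

/-! ### Firm resolvents and their bounded approximations. -/

section Resolvent

variable {E : Type*} [NormedAddCommGroup E] [InnerProductSpace ℂ E]

/-- A bounded operator `R` of the form `(1 - B)⁻¹` with `B` densely defined and dissipative. -/
structure IsFirmResolvent (R : E →L[ℂ] E) : Prop where
  firm : ∀ x, ‖R x‖ ^ 2 ≤ (⟪R x, x⟫_ℂ).re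
  dense : DenseRange R

/-- `(R + s)⁻¹`. -/
noncomputable def shiftInv (R : E →L[ℂ] E) (s : ℝ) : E →L[ℂ] E := Ring.inverse (R + s • 1)

/-- The bounded approximations `(R - 1) (R + s)⁻¹` of `B = 1 - R⁻¹`. -/
noncomputable def boundedApprox (R : E →L[ℂ] E) (s : ℝ) : E →L[ℂ] E := (R - 1) * shiftInv R s

namespace IsFirmResolvent

variable {R : E →L[ℂ] E} {s s' : ℝ}

theorem norm_apply_le (hR : IsFirmResolvent R) (x : E) : ‖R x‖ ≤ ‖x‖ := by
  have h1 := hR.firm x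
  have h2 : (⟪R x, x⟫_ℂ).re ≤ ‖R x‖ * ‖x‖ :=
    (Complex.re_le_norm _).trans (norm_inner_le_norm _ _)
  by_contra! h
  nlinarith [norm_nonneg x, norm_nonneg (R x)]

/-- Expanding the square and using firmness gives `‖R x - x‖² ≤ ‖x‖² - ‖R x‖²`. -/
theorem norm_apply_sub_le (hR : IsFirmResolvent R) (x : E) : ‖R x - x‖ ≤ ‖x‖ := by
  have h1 := hR.firm x
  have h2 := norm_sub_sq (𝕜 := ℂ) (R x) x
  rw [RCLike.re_eq_complex_re] at h2
  refine le_of_sq_le_sq ?_ (norm_nonneg _)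
  nlinarith [sq_nonneg ‖R x‖]

theorem re_inner_shift (x : E) (s : ℝ) :
    (⟪(R + s • (1 : E →L[ℂ] E)) x, x⟫_ℂ).re = (⟪R x, x⟫_ℂ).re + s * ‖x‖ ^ 2 := by
  change (⟪R x + s • x, x⟫_ℂ).re = _
  rw [RCLike.real_smul_eq_coe_smul (K := ℂ), inner_add_left, inner_smul_real_left, Complex.add_re,
    Complex.smul_re, inner_self_eq_norm_sq_to_K, smul_eq_mul]
  norm_cast

theorem norm_apply_le_norm_shift (hR : IsFirmResolvent R) (hs : 0 ≤ s) (x : E) :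
    ‖R x‖ ≤ ‖(R + s • (1 : E →L[ℂ] E)) x‖ := by
  have h0 := norm_add_sq (𝕜 := ℂ) (R x) (s • x)
  have h1 : RCLike.re ⟪R x, s • x⟫_ℂ = s * (⟪R x, x⟫_ℂ).re := by
    rw [RCLike.real_smul_eq_coe_smul (K := ℂ), inner_smul_real_right, RCLike.re_eq_complex_re,
      Complex.smul_re, smul_eq_mul]
  have h2 := (sq_nonneg _).trans (hR.firm x)
  refine le_of_sq_le_sq ?_ (norm_nonneg _)
  change _ ≤ ‖R x + s • x‖ ^ 2
  rw [h0, h1]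
  nlinarith [sq_nonneg ‖s • x‖, mul_nonneg hs h2]

theorem boundedApprox_apply (x : E) :
    boundedApprox R s x = R (shiftInv R s x) - shiftInv R s x := rfl

theorem denseRange_comp_self (hR : IsFirmResolvent R) : DenseRange fun y => R (R y) :=
  hR.dense.comp hR.dense R.continuous

variable [CompleteSpace E]

/-- Coercivity: `Re ⟨(R + s) x, x⟩ ≥ s ‖x‖²`, because firmness makes `Re ⟨R x, x⟩` nonnegative. -/
theorem isUnit_shift (hR : IsFirmResolvent R) (hs : 0 < s) :
    IsUnit (R + s • (1 : E →L[ℂ] E)) := by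
  refine ContinuousLinearMap.isUnit_of_forall_le_norm_inner_map _ (c := ⟨s, hs.le⟩) hs fun x => ?_
  refine le_trans ?_ (Complex.re_le_norm _)
  rw [re_inner_shift]
  have := (sq_nonneg _).trans (hR.firm x)
  change ‖x‖ ^ 2 * s ≤ _
  linarith

theorem shift_apply_shiftInv (hR : IsFirmResolvent R) (hs : 0 < s) (x : E) :
    (R + s • (1 : E →L[ℂ] E)) (shiftInv R s x) = x :=
  congrArg (fun f : E →L[ℂ] E => f x) (Ring.mul_inverse_cancel _ (hR.isUnit_shift hs))

theorem shiftInv_apply_shift (hR : IsFirmResolvent R) (hs : 0 < s) (x : E) :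
    shiftInv R s ((R + s • (1 : E →L[ℂ] E)) x) = x :=
  congrArg (fun f : E →L[ℂ] E => f x) (Ring.inverse_mul_cancel _ (hR.isUnit_shift hs))

theorem apply_shiftInv (hR : IsFirmResolvent R) (hs : 0 < s) (x : E) :
    R (shiftInv R s x) = x - s • shiftInv R s x :=
  eq_sub_of_add_eq (hR.shift_apply_shiftInv hs x)

theorem shiftInv_apply (hR : IsFirmResolvent R) (hs : 0 < s) (x : E) :
    shiftInv R s (R x) = R (shiftInv R s x) := by
  have h := hR.shiftInv_apply_shift hs x
  change shiftInv R s (R x + s • x) = x at h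
  rw [RCLike.real_smul_eq_coe_smul (K := ℂ), map_add, map_smul] at h
  rw [hR.apply_shiftInv hs, RCLike.real_smul_eq_coe_smul (K := ℂ)]
  exact eq_sub_of_add_eq h

theorem commute_boundedApprox (hR : IsFirmResolvent R) (hs : 0 < s) (hs' : 0 < s') :
    Commute (boundedApprox R s) (boundedApprox R s') := by
  have h0 : ∀ s : ℝ, Commute (R - 1) (R + s • 1) := fun s =>
    ((Commute.refl R).add_right ((Commute.one_right R).smul_right s)).sub_left
      (Commute.one_left _)
  have h1 : ∀ {s : ℝ}, 0 < s → Commute (R - 1) (shiftInv R s) := by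
    intro s hs
    obtain ⟨u, hu⟩ := hR.isUnit_shift hs
    have h2 := h0 s
    rw [← hu] at h2
    rw [shiftInv, ← hu, Ring.inverse_unit]
    exact h2.units_inv_right
  have h2 : Commute (shiftInv R s) (shiftInv R s') := by
    refine Commute.ringInverse_ringInverse ?_
    exact ((Commute.refl R).add_right ((Commute.one_right R).smul_right s')).add_left
      ((Commute.one_left _).smul_left s)
  exact ((Commute.refl _).mul_right (h1 hs')).mul_left ((h1 hs).symm.mul_right h2)

theorem norm_shiftInv_apply_le (hR : IsFirmResolvent R) (hs : 0 < s) (x : E) :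
    ‖shiftInv R s x‖ ≤ s⁻¹ * ‖x‖ := by
  set y := shiftInv R s x
  have h1 : (⟪x, y⟫_ℂ).re = (⟪R y, y⟫_ℂ).re + s * ‖y‖ ^ 2 := by
    rw [← re_inner_shift, hR.shift_apply_shiftInv hs]
  have h2 : (⟪x, y⟫_ℂ).re ≤ ‖x‖ * ‖y‖ := (Complex.re_le_norm _).trans (norm_inner_le_norm _ _)
  have h3 := (sq_nonneg _).trans (hR.firm y)
  rw [inv_mul_eq_div, le_div_iff₀ hs]
  by_contra! h
  have h4 : 0 < ‖y‖ := by
    by_contra! h5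
    have h6 : ‖y‖ = 0 := le_antisymm h5 (norm_nonneg _)
    rw [h6, zero_mul] at h
    exact absurd h (norm_nonneg x).not_gt
  nlinarith

theorem norm_apply_shiftInv_le (hR : IsFirmResolvent R) (hs : 0 < s) (x : E) :
    ‖R (shiftInv R s x)‖ ≤ ‖x‖ :=
  (hR.norm_apply_le_norm_shift hs.le _).trans_eq (by rw [hR.shift_apply_shiftInv hs])

/-- Put `x = R y + s y`. Then `Re ⟨R y - y, R y + s y⟩` is `‖R y‖² - Re ⟨R y, y⟩` plus `s (Re ⟨R y,
y⟩ - ‖y‖²)`. The first part is nonpositive by firmness, the second by contractivity. -/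
theorem boundedApprox_dissipative (hR : IsFirmResolvent R) (hs : 0 < s) (x : E) :
    (⟪boundedApprox R s x, x⟫_ℂ).re ≤ 0 := by
  rw [boundedApprox_apply]
  have h0 := hR.shift_apply_shiftInv hs x
  set y := shiftInv R s x
  change R y + s • y = x at h0
  rw [← h0, RCLike.real_smul_eq_coe_smul (K := ℂ), inner_sub_left, inner_add_right, inner_add_right,
    inner_smul_real_right, inner_smul_real_right]
  have hsq : ∀ z : E, (⟪z, z⟫_ℂ).re = ‖z‖ ^ 2 := fun z => by
    rw [inner_self_eq_norm_sq_to_K]; norm_cast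
  have h1 : (⟪y, R y⟫_ℂ).re = (⟪R y, y⟫_ℂ).re := inner_re_symm (𝕜 := ℂ) _ _
  have h2 := hR.firm y
  have h3 : (⟪R y, y⟫_ℂ).re ≤ ‖y‖ ^ 2 := by
    refine (Complex.re_le_norm _).trans ((norm_inner_le_norm _ _).trans ?_)
    rw [sq]
    exact mul_le_mul_of_nonneg_right (hR.norm_apply_le y) (norm_nonneg _)
  simp only [Complex.sub_re, Complex.add_re, Complex.smul_re, h1, hsq, smul_eq_mul]
  nlinarith

theorem norm_boundedApprox_le (hR : IsFirmResolvent R) (hs : 0 < s) :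
    ‖boundedApprox R s‖ ≤ s⁻¹ :=
  ContinuousLinearMap.opNorm_le_bound _ (inv_nonneg.2 hs.le) fun x =>
    (hR.norm_apply_sub_le _).trans (hR.norm_shiftInv_apply_le hs x)

theorem norm_boundedApprox_apply_apply_le (hR : IsFirmResolvent R) (hs : 0 < s) (x : E) :
    ‖boundedApprox R s (R x)‖ ≤ ‖x‖ := by
  rw [boundedApprox_apply, hR.shiftInv_apply hs]
  exact (hR.norm_apply_sub_le _).trans (hR.norm_apply_shiftInv_le hs x)

theorem boundedApprox_apply_apply (hR : IsFirmResolvent R) (hs : 0 < s) (x : E) :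
    boundedApprox R s (R x) = R (boundedApprox R s x) := by
  rw [boundedApprox_apply, boundedApprox_apply, hR.shiftInv_apply hs, map_sub]

/-- With `B = 1 - R⁻¹`, the vector `R (R y) - R y` is `B (R (R y))`. The error is `-s (R - 1) R (R +
s)⁻¹ y`, and both `R - 1` and `R (R + s)⁻¹` are contractions. The bound does not depend on `R`. -/
theorem norm_boundedApprox_sub_le (hR : IsFirmResolvent R) (hs : 0 < s) (y : E) :
    ‖boundedApprox R s (R (R y)) - (R (R y) - R y)‖ ≤ s * ‖y‖ := by
  have h1 : boundedApprox R s (R (R y)) - (R (R y) - R y) =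
      - (s • (R (R (shiftInv R s y)) - R (shiftInv R s y))) := by
    have h2 : R y = R (R (shiftInv R s y)) + s • R (shiftInv R s y) := by
      conv_lhs => rw [← hR.shift_apply_shiftInv hs y]
      change R (R (shiftInv R s y) + s • shiftInv R s y) = _
      rw [map_add, RCLike.real_smul_eq_coe_smul (K := ℂ), map_smul,
        ← RCLike.real_smul_eq_coe_smul (K := ℂ)]
    have h3 : R (R y) = R (R (R (shiftInv R s y))) + s • R (R (shiftInv R s y)) := by
      rw [h2, map_add, RCLike.real_smul_eq_coe_smul (K := ℂ), map_smul,
        ← RCLike.real_smul_eq_coe_smul (K := ℂ)]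
    rw [boundedApprox_apply, hR.shiftInv_apply hs, hR.shiftInv_apply hs, h3, h2, smul_sub]
    abel
  rw [h1, norm_neg, norm_smul, Real.norm_of_nonneg hs.le]
  exact mul_le_mul_of_nonneg_left
    ((hR.norm_apply_sub_le _).trans (hR.norm_apply_shiftInv_le hs y)) hs.le

theorem norm_boundedApprox_boundedApprox_le (hR : IsFirmResolvent R) (hs : 0 < s) (y : E) :
    ‖boundedApprox R s (boundedApprox R s (R (R y)))‖ ≤ ‖y‖ := by
  rw [hR.boundedApprox_apply_apply hs]
  refine (hR.norm_boundedApprox_apply_apply_le hs _).trans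
    (hR.norm_boundedApprox_apply_apply_le hs y)

/-- Resolvent identity: `(Rᵢ + s)⁻¹ - (R₀ + s)⁻¹ = -(Rᵢ + s)⁻¹ (Rᵢ - R₀) (R₀ + s)⁻¹`, with the left
factor bounded by `s⁻¹`. -/
theorem tendsto_shiftInv {ι : Type*} {l : Filter ι} {R : ι → E →L[ℂ] E} {R₀ : E →L[ℂ] E}
    (hR : ∀ i, IsFirmResolvent (R i)) (hR₀ : IsFirmResolvent R₀)
    (h : ∀ x, Tendsto (fun i => R i x) l (𝓝 (R₀ x))) (hs : 0 < s) (x : E) :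
    Tendsto (fun i => shiftInv (R i) s x) l (𝓝 (shiftInv R₀ s x)) := by
  rw [tendsto_iff_norm_sub_tendsto_zero]
  have h1 := ((tendsto_iff_norm_sub_tendsto_zero.1 (h (shiftInv R₀ s x))).const_mul s⁻¹)
  rw [mul_zero] at h1
  refine squeeze_zero (fun _ => norm_nonneg _) (fun i => ?_) h1
  have h2 : shiftInv (R i) s x - shiftInv R₀ s x =
      - shiftInv (R i) s (R i (shiftInv R₀ s x) - R₀ (shiftInv R₀ s x)) := by
    set y := shiftInv R₀ s x with hy
    have h3 : x = R₀ y + s • y := (hR₀.shift_apply_shiftInv hs x).symm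
    have h4 : shiftInv (R i) s (R i y + s • y) = y := (hR i).shiftInv_apply_shift hs y
    rw [h3, ← map_neg]
    calc _ = shiftInv (R i) s (R₀ y + s • y) - shiftInv (R i) s (R i y + s • y) := by rw [h4]
      _ = _ := by
        rw [← map_sub]
        congr 1
        abel
  rw [h2, norm_neg]
  exact (hR i).norm_shiftInv_apply_le hs _

theorem tendsto_boundedApprox {ι : Type*} {l : Filter ι} {R : ι → E →L[ℂ] E} {R₀ : E →L[ℂ] E}
    (hR : ∀ i, IsFirmResolvent (R i)) (hR₀ : IsFirmResolvent R₀)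
    (h : ∀ x, Tendsto (fun i => R i x) l (𝓝 (R₀ x))) (hs : 0 < s) (x : E) :
    Tendsto (fun i => boundedApprox (R i) s x) l (𝓝 (boundedApprox R₀ s x)) := by
  have hJ := tendsto_shiftInv hR hR₀ h hs x
  have h1 : ∀ i, boundedApprox (R i) s x = x - s • shiftInv (R i) s x - shiftInv (R i) s x :=
    fun i => by rw [boundedApprox_apply, (hR i).apply_shiftInv hs]
  simp only [h1]
  rw [boundedApprox_apply, hR₀.apply_shiftInv hs]
  exact (tendsto_const_nhds.sub (hJ.const_smul s)).sub hJ

end IsFirmResolvent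

end Resolvent

/-! ### Generation of the semigroup from the resolvent, and the Trotter–Kato theorem. -/

section Generation

variable {E : Type*} [NormedAddCommGroup E] [InnerProductSpace ℂ E] [CompleteSpace E]

namespace IsFirmResolvent

variable {R : E →L[ℂ] E}

theorem norm_exp_sub_exp_le (hR : IsFirmResolvent R) {s s' : ℝ} (hs : 0 < s) (hs' : 0 < s')
    {t : ℝ} (ht : 0 ≤ t) (y : E) :
    ‖NormedSpace.exp (t • boundedApprox R s) (R (R y)) -
      NormedSpace.exp (t • boundedApprox R s') (R (R y))‖ ≤ t * (s + s') * ‖y‖ := by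
  refine (norm_exp_smul_sub_exp_smul_apply_le (hR.boundedApprox_dissipative hs)
    (hR.boundedApprox_dissipative hs') (hR.commute_boundedApprox hs hs') ht _).trans ?_
  rw [mul_assoc]
  refine mul_le_mul_of_nonneg_left ?_ ht
  rw [← sub_sub_sub_cancel_right _ _ (R (R y) - R y)]
  refine (norm_sub_le _ _).trans ?_
  rw [add_mul]
  exact add_le_add (hR.norm_boundedApprox_sub_le hs y) (hR.norm_boundedApprox_sub_le hs' y)

theorem norm_exp_apply_sub_le (hR : IsFirmResolvent R) {s : ℝ} (hs : 0 < s) {t : ℝ} (ht : 0 ≤ t)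
    (x y : E) :
    ‖NormedSpace.exp (t • boundedApprox R s) x - NormedSpace.exp (t • boundedApprox R s) y‖ ≤
      ‖x - y‖ := by
  rw [← map_sub]
  exact norm_exp_smul_apply_le (hR.boundedApprox_dissipative hs) ht _

/-- `U` is the limit of the semigroups generated by the bounded approximations. -/
def IsApproxLimit (R : E →L[ℂ] E) (U : C0ContractionSemigroup E) : Prop :=
  ∀ (t : ℝ≥0) (x : E), Tendsto (fun s : ℝ => NormedSpace.exp ((t : ℝ) • boundedApprox R s) x)
    (𝓝[>] 0) (𝓝 (U.op t x))

/-- On the dense set of vectors `R (R y)` the exponentials are Cauchy as `s → 0⁺`, by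
`norm_exp_sub_exp_le`. Contractivity extends this to every vector. -/
theorem exists_tendsto_exp (hR : IsFirmResolvent R) {t : ℝ} (ht : 0 ≤ t) (x : E) :
    ∃ y, Tendsto (fun s : ℝ => NormedSpace.exp (t • boundedApprox R s) x) (𝓝[>] 0) (𝓝 y) := by
  rw [← cauchy_map_iff_exists_tendsto, Metric.cauchy_iff]
  refine ⟨inferInstance, fun ε hε => ?_⟩
  obtain ⟨y, hy⟩ := hR.denseRange_comp_self.exists_dist_lt x (show 0 < ε / 4 by positivity)
  rw [dist_eq_norm] at hy
  have h0 : Tendsto (fun s : ℝ => t * (s + s) * ‖y‖) (𝓝[>] 0) (𝓝 0) :=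
    (Continuous.tendsto' (by fun_prop) _ _ (by simp)).mono_left nhdsWithin_le_nhds
  obtain ⟨s₀, hs₀, hs₀'⟩ := ((h0.eventually (gt_mem_nhds (show 0 < ε / 2 by positivity))).and
    self_mem_nhdsWithin).exists
  refine ⟨(fun s : ℝ => NormedSpace.exp (t • boundedApprox R s) x) '' Set.Ioc 0 s₀,
    image_mem_map (Ioc_mem_nhdsGT hs₀'), ?_⟩
  rintro _ ⟨s, hs, rfl⟩ _ ⟨s', hs', rfl⟩
  rw [dist_eq_norm]
  have h1 := hR.norm_exp_apply_sub_le hs.1 ht x (R (R y))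
  have h2 := hR.norm_exp_apply_sub_le hs'.1 ht (R (R y)) x
  rw [norm_sub_rev (R (R y)) x] at h2
  have h3 := hR.norm_exp_sub_exp_le hs.1 hs'.1 ht y
  have h4 : t * (s + s') * ‖y‖ ≤ t * (s₀ + s₀) * ‖y‖ := by
    gcongr
    exacts [hs.2, hs'.2]
  rw [← sub_add_sub_cancel _ (NormedSpace.exp (t • boundedApprox R s) (R (R y))),
    ← sub_add_sub_cancel (NormedSpace.exp (t • boundedApprox R s) (R (R y)))
      (NormedSpace.exp (t • boundedApprox R s') (R (R y)))]
  refine (norm_add_le _ _).trans_lt ?_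
  have h5 := norm_add_le (NormedSpace.exp (t • boundedApprox R s) (R (R y)) -
    NormedSpace.exp (t • boundedApprox R s') (R (R y)))
    (NormedSpace.exp (t • boundedApprox R s') (R (R y)) -
    NormedSpace.exp (t • boundedApprox R s') x)
  linarith

theorem exists_semigroup (hR : IsFirmResolvent R) :
    ∃ U : C0ContractionSemigroup E, IsApproxLimit R U := by
  choose V hV using fun (t : ℝ≥0) (x : E) => hR.exists_tendsto_exp t.coe_nonneg x
  have hle : ∀ t x, ‖V t x‖ ≤ ‖x‖ := fun t x =>
    le_of_tendsto (hV t x).norm (eventually_nhdsWithin_of_forall fun s hs =>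
      norm_exp_smul_apply_le (hR.boundedApprox_dissipative hs) t.coe_nonneg x)
  have hadd : ∀ t x y, V t (x + y) = V t x + V t y := fun t x y =>
    tendsto_nhds_unique (hV t (x + y)) (((hV t x).add (hV t y)).congr fun s => (map_add _ _ _).symm)
  have hsmul : ∀ t (c : ℂ) x, V t (c • x) = c • V t x := fun t c x =>
    tendsto_nhds_unique (hV t (c • x)) (((hV t x).const_smul c).congr fun s => (map_smul _ _ _).symm)
  have hsub : ∀ t x y, ‖V t x - V t y‖ ≤ ‖x - y‖ := fun t x y => by
    have h1 := hadd t (x - y) y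
    rw [sub_add_cancel] at h1
    rw [h1, add_sub_cancel_right]
    exact hle t _
  have hzero : ∀ x, V 0 x = x := fun x =>
    tendsto_nhds_unique (hV 0 x) (tendsto_const_nhds.congr fun s => by simp)
  have hsg : ∀ t s x, V (t + s) x = V t (V s x) := by
    intro t s x
    refine tendsto_nhds_unique (hV (t + s) x) ?_
    -- Replacing the inner exponential by its limit `V s x` costs an error that the outer
    -- contraction does not enlarge.
    have h1 : Tendsto (fun r : ℝ => NormedSpace.exp ((t : ℝ) • boundedApprox R r)
        (NormedSpace.exp ((s : ℝ) • boundedApprox R r) x - V s x)) (𝓝[>] 0) (𝓝 0) := by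
      refine squeeze_zero_norm' (eventually_nhdsWithin_of_forall fun r hr =>
        norm_exp_smul_apply_le (hR.boundedApprox_dissipative hr) t.coe_nonneg _) ?_
      exact tendsto_iff_norm_sub_tendsto_zero.1 (hV s x)
    have h2 := h1.add (hV t (V s x))
    rw [zero_add] at h2
    refine h2.congr fun r => ?_
    let _ : NormedAlgebra ℚ (E →L[ℂ] E) := NormedAlgebra.restrictScalars ℚ ℂ _
    rw [map_sub, sub_add_cancel, NNReal.coe_add, add_smul,
      NormedSpace.exp_add_of_commute (((Commute.refl _).smul_left _).smul_right _)]
    rfl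
  -- Strong continuity: orbits starting in the range of `R` are Lipschitz in time, and this range is
  -- dense.
  have hlip : ∀ t y, ‖V t (R y) - R y‖ ≤ t * ‖y‖ := fun t y =>
    le_of_tendsto ((hV t (R y)).sub_const (R y)).norm (eventually_nhdsWithin_of_forall fun s hs =>
      (norm_exp_smul_apply_sub_le (hR.boundedApprox_dissipative hs) t.coe_nonneg _).trans
        (mul_le_mul_of_nonneg_left (hR.norm_boundedApprox_apply_apply_le hs y) t.coe_nonneg))
  have hlip' : ∀ t t' : ℝ≥0, t ≤ t' → ∀ y, ‖V t' (R y) - V t (R y)‖ ≤ (t' - t : ℝ) * ‖y‖ := by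
    intro t t' htt y
    have h1 : V t' (R y) = V t (V (t' - t) (R y)) := by rw [← hsg, add_tsub_cancel_of_le htt]
    rw [h1]
    refine (hsub _ _ _).trans ((hlip _ _).trans_eq ?_)
    rw [NNReal.coe_sub htt]
  have hcont : ∀ y, Continuous fun t => V t (R y) := by
    intro y
    refine continuous_iff_continuousAt.2 fun t => tendsto_iff_norm_sub_tendsto_zero.2 ?_
    have h1 : Tendsto (fun t' : ℝ≥0 => |(t' : ℝ) - t| * ‖y‖) (𝓝 t) (𝓝 0) :=
      Continuous.tendsto' (by fun_prop) _ _ (by simp)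
    refine squeeze_zero (fun _ => norm_nonneg _) (fun t' => ?_) h1
    rcases le_total t t' with h | h
    · rw [abs_of_nonneg (sub_nonneg.2 (NNReal.coe_le_coe.2 h))]
      exact hlip' t t' h y
    · rw [abs_sub_comm, norm_sub_rev, abs_of_nonneg (sub_nonneg.2 (NNReal.coe_le_coe.2 h))]
      exact hlip' t' t h y
  refine ⟨{ op := fun t => LinearMap.mkContinuous ⟨⟨V t, hadd t⟩, hsmul t⟩ 1
              fun x => (hle t x).trans_eq (one_mul _).symm
            op_zero := ContinuousLinearMap.ext hzero
            op_add := fun t s => ContinuousLinearMap.ext (hsg t s)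
            strongly_continuous := fun x => continuous_iff_continuousAt.2 fun t =>
              tendsto_of_denseRange_of_nonexpansive hR.dense (Eventually.of_forall hsub) (hsub t)
                (fun y => (hcont y).tendsto t) x
            contraction := hle }, hV⟩

namespace IsApproxLimit

variable {U : C0ContractionSemigroup E}

theorem norm_exp_sub_op_le (hU : IsApproxLimit R U) (hR : IsFirmResolvent R) {s : ℝ} (hs : 0 < s)
    (t : ℝ≥0) (y : E) :
    ‖NormedSpace.exp ((t : ℝ) • boundedApprox R s) (R (R y)) - U.op t (R (R y))‖ ≤
      t * s * ‖y‖ := by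
  have h : Tendsto (fun s' : ℝ => (t : ℝ) * (s + s') * ‖y‖) (𝓝[>] 0) (𝓝 (t * s * ‖y‖)) :=
    (Continuous.tendsto' (by fun_prop) _ _ (by simp)).mono_left nhdsWithin_le_nhds
  exact le_of_tendsto_of_tendsto (((hU t (R (R y))).const_sub _).norm) h
    (eventually_nhdsWithin_of_forall fun s' hs' => hR.norm_exp_sub_exp_le hs hs' t.coe_nonneg y)

theorem norm_op_sub_le (hU : IsApproxLimit R U) (hR : IsFirmResolvent R) (t : ℝ≥0) (y : E) :
    ‖U.op t (R y) - R y‖ ≤ t * ‖y‖ :=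
  le_of_tendsto ((hU t (R y)).sub_const (R y)).norm (eventually_nhdsWithin_of_forall fun _ hs =>
    (norm_exp_smul_apply_sub_le (hR.boundedApprox_dissipative hs) t.coe_nonneg _).trans
      (mul_le_mul_of_nonneg_left (hR.norm_boundedApprox_apply_apply_le hs y) t.coe_nonneg))

theorem norm_op_sub_sub_le (hU : IsApproxLimit R U) (hR : IsFirmResolvent R) (t : ℝ≥0) (y : E) :
    ‖U.op t (R (R y)) - R (R y) - (t : ℝ) • (R (R y) - R y)‖ ≤ (t : ℝ) ^ 2 * ‖y‖ := by
  have h0 : Tendsto (fun s : ℝ => boundedApprox R s (R (R y))) (𝓝[>] 0) (𝓝 (R (R y) - R y)) := by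
    rw [tendsto_iff_norm_sub_tendsto_zero]
    have h1 : Tendsto (fun s : ℝ => s * ‖y‖) (𝓝[>] 0) (𝓝 0) :=
      (Continuous.tendsto' (by fun_prop) _ _ (by simp)).mono_left nhdsWithin_le_nhds
    exact squeeze_zero' (Eventually.of_forall fun _ => norm_nonneg _)
      (eventually_nhdsWithin_of_forall fun s hs => hR.norm_boundedApprox_sub_le hs y) h1
  exact le_of_tendsto (((hU t (R (R y))).sub_const _).sub (h0.const_smul (t : ℝ))).norm
    (eventually_nhdsWithin_of_forall fun _ hs =>
      (norm_exp_smul_apply_sub_sub_le (hR.boundedApprox_dissipative hs) t.coe_nonneg _).trans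
        (mul_le_mul_of_nonneg_left (hR.norm_boundedApprox_boundedApprox_le hs y) (sq_nonneg _)))

/-- For `w = R y` the second-order estimate gives an error of at most `t ‖y‖`. For general `w`,
density applies: `norm_op_sub_le` makes the quotients nonexpansive in `w`, uniformly in `t`. -/
theorem tendsto_quotient (hU : IsApproxLimit R U) (hR : IsFirmResolvent R) (w : E) :
    Tendsto (fun t : ℝ≥0 => (t : ℝ)⁻¹ • (U.op t (R w) - R w)) (𝓝[>] 0) (𝓝 (R w - w)) := by
  refine tendsto_of_denseRange_of_nonexpansive
    (F := fun (t : ℝ≥0) w => (t : ℝ)⁻¹ • (U.op t (R w) - R w)) (F₀ := fun w => R w - w) hR.dense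
    (eventually_nhdsWithin_of_forall fun t (ht : 0 < t) x y => ?_) (fun x y => ?_) (fun y => ?_) w
  · have ht' : (0 : ℝ) < t := ht
    rw [← smul_sub, sub_sub_sub_comm, ← map_sub, ← map_sub R, norm_smul, norm_inv,
      Real.norm_of_nonneg ht'.le, inv_mul_eq_div, div_le_iff₀ ht', mul_comm]
    exact hU.norm_op_sub_le hR t _
  · rw [sub_sub_sub_comm, ← map_sub]
    exact hR.norm_apply_sub_le _
  · rw [tendsto_iff_norm_sub_tendsto_zero]
    have h1 : Tendsto (fun t : ℝ≥0 => (t : ℝ) * ‖y‖) (𝓝[>] 0) (𝓝 0) :=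
      (Continuous.tendsto' (by fun_prop) _ _ (by simp)).mono_left nhdsWithin_le_nhds
    refine squeeze_zero' (Eventually.of_forall fun _ => norm_nonneg _)
      (eventually_nhdsWithin_of_forall fun t (ht : 0 < t) => ?_) h1
    have ht' : (0 : ℝ) < t := ht
    have h2 : (t : ℝ)⁻¹ • (U.op t (R (R y)) - R (R y)) - (R (R y) - R y) =
        (t : ℝ)⁻¹ • (U.op t (R (R y)) - R (R y) - (t : ℝ) • (R (R y) - R y)) := by
      rw [smul_sub (t : ℝ)⁻¹ (_ - _) _, inv_smul_smul₀ ht'.ne']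
    rw [h2, norm_smul, norm_inv, Real.norm_of_nonneg ht'.le, inv_mul_eq_div, div_le_iff₀ ht']
    exact (hU.norm_op_sub_sub_le hR t y).trans_eq (by ring)

/-- The generator of `U` is `1 - R⁻¹`. -/
theorem tendsto_quotient_iff (hU : IsApproxLimit R U) (hR : IsFirmResolvent R) (x y : E) :
    Tendsto (fun t : ℝ≥0 => (t : ℝ)⁻¹ • (U.op t x - x)) (𝓝[>] 0) (𝓝 y) ↔
      ∃ w, R w = x ∧ R w - w = y := by
  constructor
  · intro h
    have h1 := hU.tendsto_quotient hR (x - y)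
    -- Subtracting the known quotient limit at `R (x - y)` shows that the generator sends `d` to `d`
    -- itself. Dissipativity then gives `‖d‖² ≤ 0`, hence `x = R (x - y)`.
    set d := x - R (x - y) with hd
    have h2 : Tendsto (fun t : ℝ≥0 => (t : ℝ)⁻¹ • (U.op t d - d)) (𝓝[>] 0) (𝓝 d) := by
      have h3 : y - (R (x - y) - (x - y)) = d := by rw [hd]; abel
      have h4 := h.sub h1
      rw [h3] at h4
      refine h4.congr fun t => ?_
      rw [← smul_sub, sub_sub_sub_comm, ← map_sub]
    have h3 := U.re_inner_le_zero h2
    rw [inner_self_eq_norm_sq_to_K] at h3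
    norm_cast at h3
    have h4 : d = 0 := by
      rw [← norm_le_zero_iff]
      by_contra! h5
      exact absurd h3 (not_le.2 (pow_pos h5 2))
    have h5 : R (x - y) = x := (sub_eq_zero.1 h4).symm
    exact ⟨x - y, h5, by rw [h5]; abel⟩
  · rintro ⟨w, rfl, rfl⟩
    exact hU.tendsto_quotient hR w

/-- Strong convergence of the resolvents implies strong convergence of the semigroups. -/
theorem tendsto_op {ι : Type*} {l : Filter ι} {R : ι → E →L[ℂ] E} {R₀ : E →L[ℂ] E}
    {U : ι → C0ContractionSemigroup E} {U₀ : C0ContractionSemigroup E}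
    (hU : ∀ i, IsApproxLimit (R i) (U i)) (hU₀ : IsApproxLimit R₀ U₀)
    (hR : ∀ i, IsFirmResolvent (R i)) (hR₀ : IsFirmResolvent R₀)
    (h : ∀ x, Tendsto (fun i => R i x) l (𝓝 (R₀ x))) (t : ℝ≥0) (x : E) :
    Tendsto (fun i => (U i).op t x) l (𝓝 (U₀.op t x)) := by
  refine tendsto_of_denseRange_of_nonexpansive (F := fun i => (U i).op t) (F₀ := U₀.op t)
    hR₀.denseRange_comp_self (Eventually.of_forall fun i => (U i).norm_op_sub_le t)
    (U₀.norm_op_sub_le t) (fun y => ?_) x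
  -- The rate estimate for `U i` holds at `R i (R i y)`, not at `R₀ (R₀ y)`, so the test vector
  -- moves with `i`.
  have hz : Tendsto (fun i => R i (R i y)) l (𝓝 (R₀ (R₀ y))) := by
    have h1 : Tendsto (fun i => R i (R i y - R₀ y)) l (𝓝 0) :=
      squeeze_zero_norm (fun i => (hR i).norm_apply_le _)
        (tendsto_iff_norm_sub_tendsto_zero.1 (h y))
    have h2 := h1.add (h (R₀ y))
    rw [zero_add] at h2
    exact h2.congr fun i => by rw [map_sub, sub_add_cancel]
  rw [Metric.tendsto_nhds]
  intro ε hε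
  have h0 : Tendsto (fun s : ℝ => t * s * ‖y‖) (𝓝[>] 0) (𝓝 0) :=
    (Continuous.tendsto' (by fun_prop) _ _ (by simp)).mono_left nhdsWithin_le_nhds
  -- Five errors: two changes of test vector, two passages between a semigroup and its exponential
  -- approximation, and one convergence of exponentials. The parameter `s` is fixed before `i`,
  -- since the rate is uniform in `i`.
  obtain ⟨s, hs, hs'⟩ := ((h0.eventually (gt_mem_nhds (show 0 < ε / 5 by positivity))).and
    self_mem_nhdsWithin).exists
  have hexp := tendsto_exp_smul_apply (fun i => (hR i).norm_boundedApprox_le hs')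
    (fun x => tendsto_boundedApprox hR hR₀ h hs' x) t (R₀ (R₀ y))
  filter_upwards [Metric.tendsto_nhds.1 hz (ε / 5) (by positivity),
    Metric.tendsto_nhds.1 hexp (ε / 5) (by positivity)] with i hi1 hi2
  have h1 := (U i).norm_op_sub_le t (R₀ (R₀ y)) (R i (R i y))
  have h2 := (hU i).norm_exp_sub_op_le (hR i) hs' t y
  have h3 := (hR i).norm_exp_apply_sub_le hs' t.coe_nonneg (R i (R i y)) (R₀ (R₀ y))
  have h4 := hU₀.norm_exp_sub_op_le hR₀ hs' t y
  simp only [← dist_eq_norm] at h1 h2 h3 h4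
  rw [dist_comm (R₀ (R₀ y))] at h1
  rw [dist_comm] at h2
  refine (dist_triangle4 _ ((U i).op t (R i (R i y))) (NormedSpace.exp ((t : ℝ) • boundedApprox (R i) s) (R i (R i y)))
    _).trans_lt ?_
  have h5 := dist_triangle4 (NormedSpace.exp ((t : ℝ) • boundedApprox (R i) s) (R i (R i y)))
    (NormedSpace.exp ((t : ℝ) • boundedApprox (R i) s) (R₀ (R₀ y)))
    (NormedSpace.exp ((t : ℝ) • boundedApprox R₀ s) (R₀ (R₀ y))) (U₀.op t (R₀ (R₀ y)))
  linarith

end IsApproxLimit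

end IsFirmResolvent

end Generation

/-! ### Dissipative operators satisfying the range condition. -/

section LumerPhillips

variable {E : Type*} [NormedAddCommGroup E] [InnerProductSpace ℂ E]

theorem IsDissipative.re_inner_le_zero {B : E →ₗ.[ℂ] E} (hB : IsDissipative B) {x y : E}
    (h : (x, y) ∈ B.graph) : (⟪y, x⟫_ℂ).re ≤ 0 := by
  rw [LinearPMap.mem_graph_iff] at h
  obtain ⟨z, rfl, rfl⟩ := h
  exact hB z

/-- Here `x` solves `(1 - B / c) x = w`. For such `x`, dissipativity is precisely the firmness
inequality of the resolvent. -/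
theorem IsDissipative.norm_sq_le {B : E →ₗ.[ℂ] E} (hB : IsDissipative B) {c : ℝ} (hc : 0 < c)
    {x y w : E} (h : (x, y) ∈ B.graph) (hy : y = c • (x - w)) :
    ‖x‖ ^ 2 ≤ (⟪x, w⟫_ℂ).re := by
  have h1 := hB.re_inner_le_zero h
  have h2 : (⟪x, x⟫_ℂ).re = ‖x‖ ^ 2 := by
    rw [inner_self_eq_norm_sq_to_K]; norm_cast
  rw [hy, RCLike.real_smul_eq_coe_smul (K := ℂ), inner_smul_real_left, inner_sub_left,
    Complex.smul_re, Complex.sub_re, h2, smul_eq_mul] at h1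
  have h3 : (⟪x, w⟫_ℂ).re = (⟪w, x⟫_ℂ).re := inner_re_symm (𝕜 := ℂ) _ _
  rw [h3]
  exact sub_nonpos.1 (nonpos_of_mul_nonpos_right h1 hc)

theorem IsDissipative.eq_of_range {B : E →ₗ.[ℂ] E} (hB : IsDissipative B) {c : ℝ} (hc : 0 < c)
    {x x' w : E} (h : (x, c • (x - w)) ∈ B.graph) (h' : (x', c • (x' - w)) ∈ B.graph) :
    x = x' := by
  have h1 := B.graph.sub_mem h h'
  have h2 := hB.norm_sq_le hc (w := 0) h1 (by
    change c • (x - w) - c • (x' - w) = c • (x - x' - 0)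
    rw [← smul_sub, sub_sub_sub_cancel_right, sub_zero])
  rw [inner_zero_right, Complex.zero_re] at h2
  exact sub_eq_zero.1 (norm_eq_zero.1 (pow_eq_zero_iff two_ne_zero |>.1
    (le_antisymm h2 (sq_nonneg _))))

/-- The range condition implies maximality. -/
theorem IsDissipative.isMaximallyDissipative {B : E →ₗ.[ℂ] E} (hB : IsDissipative B) {c : ℝ}
    (hc : 0 < c) (hr : ∀ w, ∃ x, (x, c • (x - w)) ∈ B.graph) : IsMaximallyDissipative B := by
  refine ⟨hB, fun A hA hBA => le_antisymm (LinearPMap.le_of_le_graph ?_) hBA⟩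
  rintro ⟨x, y⟩ h
  -- The vector `w = x - y / c` is chosen so that `y = c (x - w)`. Solving with the same `w` inside
  -- `B` and using injectivity of `1 - A / c` puts `x` into the domain of `B`.
  obtain ⟨x', hx'⟩ := hr (x - c⁻¹ • y)
  have h1 : y = c • (x - (x - c⁻¹ • y)) := by rw [sub_sub_cancel, smul_inv_smul₀ hc.ne']
  have h2 : (x, c • (x - (x - c⁻¹ • y))) ∈ A.graph := by rwa [← h1]
  have h3 : x = x' := hA.eq_of_range hc h2 (LinearPMap.le_graph_of_le hBA hx')
  rw [← h3, ← h1] at hx'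
  exact hx'

/-- `R = (1 - B / c)⁻¹`. -/
def IsResolventAt (R : E →L[ℂ] E) (c : ℝ) (B : E →ₗ.[ℂ] E) : Prop :=
  ∀ x y, (x, y) ∈ B.graph ↔ ∃ w, R w = x ∧ c • (R w - w) = y

theorem IsResolventAt.apply_eq {R : E →L[ℂ] E} {c : ℝ} {B : E →ₗ.[ℂ] E} (hR : IsResolventAt R c B)
    (hc : c ≠ 0) {x w : E} (h : (x, c • (x - w)) ∈ B.graph) : R w = x := by
  obtain ⟨w', h1, h2⟩ := (hR _ _).1 h
  have h3 := smul_right_injective E hc h2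
  simp only [h1] at h3
  rw [← sub_right_injective h3, h1]

/-- Solutions of `(1 - B / c) x = w` are unique, so any choice of them is automatically linear in
`w`. Density of the range of `R` is density of the domain of `B`. -/
theorem IsDissipative.exists_resolvent {B : E →ₗ.[ℂ] E} (hB : IsDissipative B) {c : ℝ}
    (hc : 0 < c) (hd : Dense (B.domain : Set E)) (hr : ∀ w, ∃ x, (x, c • (x - w)) ∈ B.graph) :
    ∃ R : E →L[ℂ] E, IsFirmResolvent R ∧ IsResolventAt R c B := by
  choose f hf using hr
  have hfirm : ∀ w, ‖f w‖ ^ 2 ≤ (⟪f w, w⟫_ℂ).re := fun w => hB.norm_sq_le hc (hf w) rfl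
  have hle : ∀ w, ‖f w‖ ≤ 1 * ‖w‖ := fun w => by
    have h1 := hfirm w
    have h2 : (⟪f w, w⟫_ℂ).re ≤ ‖f w‖ * ‖w‖ :=
      (Complex.re_le_norm _).trans (norm_inner_le_norm _ _)
    by_contra! h
    nlinarith [norm_nonneg w, norm_nonneg (f w)]
  have hadd : ∀ w w', f (w + w') = f w + f w' := fun w w' => by
    refine hB.eq_of_range hc (hf _) ?_
    have h1 := B.graph.add_mem (hf w) (hf w')
    rwa [Prod.mk_add_mk, ← smul_add, sub_add_sub_comm] at h1
  have hsmul : ∀ (a : ℂ) w, f (a • w) = a • f w := fun a w => by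
    refine hB.eq_of_range hc (hf _) ?_
    have h1 := B.graph.smul_mem a (hf w)
    rwa [Prod.smul_mk, smul_comm a c, smul_sub a] at h1
  let R : E →L[ℂ] E := LinearMap.mkContinuous ⟨⟨f, hadd⟩, hsmul⟩ 1 hle
  have hR : IsResolventAt R c B := by
    intro x y
    constructor
    · intro h
      have h1 : y = c • (x - (x - c⁻¹ • y)) := by rw [sub_sub_cancel, smul_inv_smul₀ hc.ne']
      have h2 : f (x - c⁻¹ • y) = x := hB.eq_of_range hc (hf _) (by rwa [← h1])
      refine ⟨x - c⁻¹ • y, h2, ?_⟩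
      change c • (f _ - _) = y
      rw [h2, ← h1]
    · rintro ⟨w, rfl, rfl⟩
      exact hf w
  refine ⟨R, ⟨hfirm, hd.mono fun x hx => ?_⟩, hR⟩
  obtain ⟨w, hw, -⟩ := (hR _ _).1 (B.mem_graph ⟨x, hx⟩)
  exact ⟨w, hw⟩

theorem IsFirmResolvent.IsApproxLimit.isGeneratedBy [CompleteSpace E] {R : E →L[ℂ] E}
    {U : C0ContractionSemigroup E} (hU : IsFirmResolvent.IsApproxLimit R U)
    (hR : IsFirmResolvent R) {c : ℝ≥0} (hc : 0 < c) {B : E →ₗ.[ℂ] E} (hB : IsResolventAt R c B) :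
    (U.rescale c).IsGeneratedBy B := by
  intro x y
  rw [U.tendsto_rescale_iff hc, hU.tendsto_quotient_iff hR, hB]
  have hc' : (c : ℝ) ≠ 0 := NNReal.coe_ne_zero.2 hc.ne'
  refine exists_congr fun w => and_congr_right fun _ => ?_
  rw [eq_inv_smul_iff₀ hc']

end LumerPhillips

/-! ### Extensions of a symmetric operator defined by contractions between the deficiency spaces. -/

section Extension

variable {E : Type*} [NormedAddCommGroup E] [InnerProductSpace ℂ E]

theorem mem_graph_evolutionOperator_iff {ħ : ℝ} {X : E →ₗ.[ℂ] E} {x y : E} :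
    (x, y) ∈ (evolutionOperator ħ X).graph ↔
      ∃ z, (x, z) ∈ X.graph ∧ (-Complex.I / (ħ : ℂ)) • z = y := by
  simp only [LinearPMap.mem_graph_iff]
  constructor
  · rintro ⟨a, ha, h⟩
    exact ⟨X a, ⟨a, ha, rfl⟩, h⟩
  · rintro ⟨_, ⟨a, ha, rfl⟩, h⟩
    exact ⟨a, ha, h⟩

theorem evolutionOperator_mono {ħ : ℝ} {X Y : E →ₗ.[ℂ] E} (h : X ≤ Y) :
    evolutionOperator ħ X ≤ evolutionOperator ħ Y := by
  refine LinearPMap.le_of_le_graph ?_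
  rintro ⟨x, y⟩ hxy
  obtain ⟨z, hz, hz'⟩ := mem_graph_evolutionOperator_iff.1 hxy
  exact mem_graph_evolutionOperator_iff.2 ⟨z, LinearPMap.le_graph_of_le h hz, hz'⟩

variable [CompleteSpace E] {H : E →ₗ.[ℂ] E}

theorem mem_adjoint_graph_of_mem_adjointEigenspace {z : ℂ} {x : E}
    (hx : x ∈ adjointEigenspace H z) : (x, z • x) ∈ H.adjoint.graph := by
  obtain ⟨h, h'⟩ := (mem_adjointEigenspace_iff H z x).1 hx
  rw [← h']
  exact H.adjoint.mem_graph ⟨x, h⟩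

theorem LinearPMap.IsFormalAdjoint.isClosable (hsym : H.IsFormalAdjoint H)
    (hd : Dense (H.domain : Set E)) : H.IsClosable :=
  (LinearPMap.adjoint_isClosed hd).isClosable.leIsClosable (hsym.le_adjoint hd)

theorem LinearPMap.IsFormalAdjoint.closure_le_adjoint (hsym : H.IsFormalAdjoint H)
    (hd : Dense (H.domain : Set E)) : H.closure ≤ H.adjoint := by
  refine LinearPMap.le_of_le_graph ?_
  rw [← (hsym.isClosable hd).graph_closure_eq_closure_graph]
  exact Submodule.topologicalClosure_minimal _
    (LinearPMap.le_graph_of_le (hsym.le_adjoint hd)) (LinearPMap.adjoint_isClosed hd)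

/-- For fixed `(x, y)` the identity is a closed condition on `(a, b)`, and it holds on the graph of
`H` by definition of the adjoint. -/
theorem LinearPMap.IsFormalAdjoint.inner_closure_eq (hsym : H.IsFormalAdjoint H)
    (hd : Dense (H.domain : Set E)) {a b x y : E} (hab : (a, b) ∈ H.closure.graph)
    (hxy : (x, y) ∈ H.adjoint.graph) : ⟪b, x⟫_ℂ = ⟪a, y⟫_ℂ := by
  have hc : _root_.IsClosed {p : E × E | ⟪p.2, x⟫_ℂ = ⟪p.1, y⟫_ℂ} :=
    isClosed_eq (by fun_prop) (by fun_prop)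
  have hsub : (H.graph : Set (E × E)) ⊆ {p : E × E | ⟪p.2, x⟫_ℂ = ⟪p.1, y⟫_ℂ} := by
    rintro ⟨p, q⟩ hp
    obtain ⟨u, rfl, rfl⟩ := (LinearPMap.mem_graph_iff _).1 hp
    obtain ⟨v, rfl, rfl⟩ := (LinearPMap.mem_graph_iff _).1 hxy
    exact (LinearPMap.adjoint_isFormalAdjoint hd).symm u v
  rw [← (hsym.isClosable hd).graph_closure_eq_closure_graph] at hab
  exact closure_minimal hsub hc hab

/-- The range of `1 + i H̄` is closed and its orthogonal complement is `Ker (i + H*)`. -/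
theorem LinearPMap.IsFormalAdjoint.exists_decomposition (hsym : H.IsFormalAdjoint H)
    (hd : Dense (H.domain : Set E)) (y : E) :
    ∃ a b, (a, b) ∈ H.closure.graph ∧
      ∃ m : kerMinus H, a + Complex.I • b + (2 : ℂ) • (m : E) = y := by
  have hle := LinearPMap.le_graph_of_le (hsym.closure_le_adjoint hd)
  have hclosed : _root_.IsClosed (H.closure.graph : Set (E × E)) := (hsym.isClosable hd).closure_isClosed
  let L : E × E →L[ℂ] E :=
    ContinuousLinearMap.fst ℂ E E + Complex.I • ContinuousLinearMap.snd ℂ E E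
  let f : H.closure.graph →L[ℂ] E := L.comp H.closure.graph.subtypeL
  -- Since `⟨a, b⟩` is real, `‖a + i b‖² = ‖a‖² + ‖b‖²`. So `f` is bounded below on the closed graph
  -- and has closed range.
  have hanti : AntilipschitzWith 1 f := by
    refine f.antilipschitz_of_bound fun p => ?_
    obtain ⟨⟨a, b⟩, hp⟩ := p
    have h1 := hsym.inner_closure_eq hd hp (hle hp)
    have h2 := norm_add_sq (𝕜 := ℂ) a (Complex.I • b)
    have h3 : RCLike.re ⟪a, Complex.I • b⟫_ℂ = 0 := by
      have h4 : (⟪a, b⟫_ℂ).im = 0 := by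
        have h5 := congrArg Complex.im h1
        rw [← inner_conj_symm, Complex.conj_im] at h5
        linarith
      rw [inner_smul_right, RCLike.re_eq_complex_re, Complex.mul_re, h4]
      simp
    rw [h3, norm_smul, Complex.norm_I, one_mul] at h2
    change max ‖a‖ ‖b‖ ≤ ((1 : ℝ≥0) : ℝ) * ‖a + Complex.I • b‖
    rw [NNReal.coe_one, one_mul]
    refine max_le ?_ ?_ <;> refine le_of_sq_le_sq ?_ (norm_nonneg _) <;>
      nlinarith [sq_nonneg ‖a‖, sq_nonneg ‖b‖]
  have : CompleteSpace H.closure.graph := hclosed.completeSpace_coe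
  have hrange : _root_.IsClosed (LinearMap.range f.toLinearMap : Set E) :=
    hanti.isClosed_range f.uniformContinuous
  have : CompleteSpace (LinearMap.range f.toLinearMap) := hrange.completeSpace_coe
  obtain ⟨u, hu, v, hv, huv⟩ := (LinearMap.range f.toLinearMap).exists_add_mem_mem_orthogonal y
  obtain ⟨⟨⟨a, b⟩, hab⟩, rfl⟩ := hu
  have hinner : ∀ x : H.domain, ⟪(-Complex.I) • v, (x : E)⟫_ℂ = ⟪v, H x⟫_ℂ := by
    intro x
    have h1 : ((x : E), H x) ∈ H.closure.graph :=
      LinearPMap.le_graph_of_le H.le_closure (H.mem_graph x)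
    have h2 : ⟪v, (x : E) + Complex.I • H x⟫_ℂ = 0 :=
      Submodule.inner_left_of_mem_orthogonal (LinearMap.mem_range.2 ⟨⟨_, h1⟩, rfl⟩) hv
    rw [inner_add_right, inner_smul_right] at h2
    have h3 : (starRingEnd ℂ) (-Complex.I) = Complex.I := by simp
    rw [inner_smul_left, h3, eq_neg_of_add_eq_zero_left h2]
    linear_combination -⟪v, H x⟫_ℂ * Complex.I_sq
  have hker : v ∈ kerMinus H :=
    (mem_adjointEigenspace_iff _ _ _).2 ⟨LinearPMap.mem_adjoint_domain_of_exists v ⟨_, hinner⟩,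
      LinearPMap.adjoint_apply_eq hd _ hinner⟩
  -- The factor `2` matches `(1 + i H*) m = 2 m` on `kerMinus H`.
  refine ⟨a, b, hab, (2 : ℂ)⁻¹ • ⟨v, hker⟩, ?_⟩
  rw [Submodule.coe_smul, smul_inv_smul₀ two_ne_zero, huv]
  rfl

variable {T : kerMinus H →L[ℂ] kerPlus H}

/-- `H*` acts on the three summands as the closure of `H`, as `i` and as `-i`. Uniqueness of the
decomposition is not needed. -/
theorem mem_graph_extensionOf_iff (hsym : H.IsFormalAdjoint H) (hd : Dense (H.domain : Set E))
    {x y : E} : (x, y) ∈ (extensionOf H T).graph ↔ ∃ a b, (a, b) ∈ H.closure.graph ∧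
      ∃ m : kerMinus H, x = a + T m + m ∧ y = b + Complex.I • (T m : E) - Complex.I • (m : E) := by
  have hle := LinearPMap.le_graph_of_le (hsym.closure_le_adjoint hd)
  have hadj : ∀ {a b : E} (m : kerMinus H), (a, b) ∈ H.closure.graph →
      (a + (T m : E) + m, b + Complex.I • (T m : E) - Complex.I • (m : E)) ∈ H.adjoint.graph := by
    intro a b m hab
    have h1 := H.adjoint.graph.add_mem (H.adjoint.graph.add_mem (hle hab)
      (mem_adjoint_graph_of_mem_adjointEigenspace (T m).2))
      (mem_adjoint_graph_of_mem_adjointEigenspace m.2)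
    rwa [Prod.mk_add_mk, Prod.mk_add_mk, neg_smul, ← sub_eq_add_neg] at h1
  have hgraph : (x, y) ∈ (extensionOf H T).graph ↔
      x ∈ extensionSubspace H T ∧ (x, y) ∈ H.adjoint.graph := by
    constructor
    · intro h
      refine ⟨?_, LinearPMap.le_graph_of_le LinearPMap.domRestrict_le h⟩
      obtain ⟨u, rfl, -⟩ := (LinearPMap.mem_graph_iff _).1 h
      exact u.2.1
    · rintro ⟨h1, h2⟩
      obtain ⟨u, rfl, rfl⟩ := (LinearPMap.mem_graph_iff _).1 h2
      exact (LinearPMap.mem_graph_iff _).2 ⟨⟨u, h1, u.2⟩, rfl, LinearPMap.domRestrict_apply rfl⟩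
  rw [hgraph, mem_extensionSubspace_iff]
  constructor
  · rintro ⟨⟨a, ha, p, m, rfl, rfl⟩, h⟩
    have hab := H.closure.mem_graph ⟨a, ha⟩
    exact ⟨a, _, hab, m, rfl, LinearPMap.mem_graph_snd_inj' _ h (hadj m hab) rfl⟩
  · rintro ⟨a, b, hab, m, rfl, rfl⟩
    obtain ⟨u, rfl, -⟩ := (LinearPMap.mem_graph_iff _).1 hab
    exact ⟨⟨u, u.2, T m, m, rfl, rfl⟩, hadj m hab⟩

theorem le_extensionOf (hsym : H.IsFormalAdjoint H) (hd : Dense (H.domain : Set E)) :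
    H ≤ extensionOf H T := by
  refine LinearPMap.le_of_le_graph ?_
  rintro ⟨x, y⟩ h
  exact (mem_graph_extensionOf_iff hsym hd).2
    ⟨x, y, LinearPMap.le_graph_of_le H.le_closure h, 0, by simp, by simp⟩

theorem isDissipative_extensionOf (hsym : H.IsFormalAdjoint H) (hd : Dense (H.domain : Set E))
    (hT : ‖T‖ ≤ 1) {ħ : ℝ} (hħ : 0 < ħ) :
    IsDissipative (evolutionOperator ħ (extensionOf H T)) := by
  intro x
  obtain ⟨z, hz, hz'⟩ :=
    mem_graph_evolutionOperator_iff.1 ((evolutionOperator ħ (extensionOf H T)).mem_graph x)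
  obtain ⟨a, b, hab, m, hx, rfl⟩ := (mem_graph_extensionOf_iff hsym hd).1 hz
  have hle := LinearPMap.le_graph_of_le (hsym.closure_le_adjoint hd)
  rw [← hz', hx]
  have hn : ‖(T m : E)‖ ≤ ‖(m : E)‖ := (T.le_of_opNorm_le hT m).trans_eq (one_mul _)
  have hp := hsym.inner_closure_eq hd hab (mem_adjoint_graph_of_mem_adjointEigenspace (T m).2)
  have hm := hsym.inner_closure_eq hd hab (mem_adjoint_graph_of_mem_adjointEigenspace m.2)
  have ha := hsym.inner_closure_eq hd hab (hle hab)
  set p : E := ((T m : kerPlus H) : E)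
  set q : E := (m : E)
  have hsq : ∀ z : E, (⟪z, z⟫_ℂ).re = ‖z‖ ^ 2 := fun z => by
    rw [inner_self_eq_norm_sq_to_K]; norm_cast
  have hre : ∀ u v : E, (⟪u, v⟫_ℂ).re = (⟪v, u⟫_ℂ).re := fun u v => inner_re_symm (𝕜 := ℂ) u v
  have him : (⟪b, a⟫_ℂ).im = 0 := by
    have h5 := congrArg Complex.im ha
    rw [← inner_conj_symm a b, Complex.conj_im] at h5
    linarith
  -- All terms involving `a` and `b` cancel by symmetry, and the cross terms of `p` and `q` cancel
  -- in the imaginary part.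
  have hmain : (⟪b + Complex.I • p - Complex.I • q, a + p + q⟫_ℂ).im = ‖q‖ ^ 2 - ‖p‖ ^ 2 := by
    simp only [inner_add_left, inner_add_right, inner_sub_left, inner_smul_left, hp, hm,
      inner_smul_right, Complex.add_im, Complex.sub_im, Complex.mul_im, Complex.conj_I,
      Complex.neg_im, Complex.neg_re, Complex.I_re, Complex.I_im, him, hsq]
    rw [hre p a, hre q a, hre q p]
    ring
  have hconj : (starRingEnd ℂ) (-Complex.I / (ħ : ℂ)) = ((ħ⁻¹ : ℝ) : ℂ) * Complex.I := by
    rw [map_div₀, map_neg, Complex.conj_I, neg_neg, Complex.conj_ofReal, Complex.ofReal_inv,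
      div_eq_inv_mul]
  rw [inner_smul_left, hconj, mul_assoc, Complex.re_ofReal_mul, Complex.I_mul_re, hmain]
  have h1 : ‖p‖ ^ 2 ≤ ‖q‖ ^ 2 := pow_le_pow_left₀ (norm_nonneg _) hn 2
  exact mul_nonpos_of_nonneg_of_nonpos (inv_nonneg.2 hħ.le) (by linarith)

/-- The solution of `(1 - ħ B) x = w` for `B = (-i / ħ) H_T`. -/
theorem mem_graph_evolutionOperator_extensionOf (hsym : H.IsFormalAdjoint H)
    (hd : Dense (H.domain : Set E)) {ħ : ℝ} {a b : E} (hab : (a, b) ∈ H.closure.graph)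
    (m : kerMinus H) :
    (a + (T m : E) + m, ħ⁻¹ • (a + (T m : E) + m - (a + Complex.I • b + (2 : ℂ) • (m : E)))) ∈
      (evolutionOperator ħ (extensionOf H T)).graph := by
  refine mem_graph_evolutionOperator_iff.2
    ⟨_, (mem_graph_extensionOf_iff hsym hd).2 ⟨a, b, hab, m, rfl, rfl⟩, ?_⟩
  have h1 : -Complex.I / (ħ : ℂ) = ((ħ⁻¹ : ℝ) : ℂ) * -Complex.I := by
    rw [Complex.ofReal_inv, div_eq_inv_mul]
  rw [h1, mul_smul, RCLike.real_smul_eq_coe_smul (K := ℂ)]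
  congr 1
  simp only [smul_add, smul_sub, smul_smul, neg_mul, Complex.I_mul_I, neg_neg, one_smul, neg_smul,
    two_smul]
  abel

end Extension

/-! ### The main theorem. -/

theorem mainTheorem6 :
    -- the three-body Hamiltonian is densely defined and symmetric, so the second part applies to it
    (∀ ħ m : ℝ, 0 < ħ → 0 ≤ m →
      Dense ((ThreeBody.hamiltonian ħ m).domain : Set ThreeBody.L2) ∧
        (ThreeBody.hamiltonian ħ m).IsFormalAdjoint (ThreeBody.hamiltonian ħ m)) ∧
    ∀ (E : Type*) [NormedAddCommGroup E] [InnerProductSpace ℂ E] [CompleteSpace E]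
      (H : E →ₗ.[ℂ] E), Dense (H.domain : Set E) → H.IsFormalAdjoint H → ∀ ħ : ℝ, 0 < ħ →
      -- every contraction defines a maximally dissipative extension, which generates a semigroup
      (∀ T : kerMinus H →L[ℂ] kerPlus H, ‖T‖ ≤ 1 →
        evolutionOperator ħ H ≤ evolutionOperator ħ (extensionOf H T) ∧
        Dense ((evolutionOperator ħ (extensionOf H T)).domain : Set E) ∧
        IsMaximallyDissipative (evolutionOperator ħ (extensionOf H T)) ∧
        ∃! U : C0ContractionSemigroup E,
          U.IsGeneratedBy (evolutionOperator ħ (extensionOf H T))) ∧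
      -- strong convergence of the contractions implies strong convergence of the semigroups
      (∀ (T : ℝ → kerMinus H →L[ℂ] kerPlus H) (T₀ : kerMinus H →L[ℂ] kerPlus H)
        (U : ℝ → C0ContractionSemigroup E),
        (∀ ε, 0 < ε → ‖T ε‖ ≤ 1) →
        (∀ ε, 0 < ε → (U ε).IsGeneratedBy (evolutionOperator ħ (extensionOf H (T ε)))) →
        ‖T₀‖ ≤ 1 →
        (∀ x : kerMinus H, Tendsto (fun ε => T ε x) (𝓝[>] 0) (𝓝 (T₀ x))) →
        ∃ U₀ : C0ContractionSemigroup E,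
          (∀ (t : ℝ≥0) (x : E), Tendsto (fun ε => (U ε).op t x) (𝓝[>] 0) (𝓝 (U₀.op t x))) ∧
          U₀.IsGeneratedBy (evolutionOperator ħ (extensionOf H T₀)) ∧
          IsMaximallyDissipative (evolutionOperator ħ (extensionOf H T₀))) := by
  refine ⟨fun ħ m _ _ => ⟨ThreeBody.hamiltonian_dense ħ m, ThreeBody.hamiltonian_symmetric ħ m⟩, ?_⟩
  intro E _ _ _ H hd hsym ħ hħ
  have hc : (0 : ℝ) < ħ⁻¹ := inv_pos.2 hħ
  let c : ℝ≥0 := ⟨ħ⁻¹, hc.le⟩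
  have hdense : ∀ T : kerMinus H →L[ℂ] kerPlus H,
      Dense ((evolutionOperator ħ (extensionOf H T)).domain : Set E) := fun T =>
    hd.mono (evolutionOperator_mono (ħ := ħ) (le_extensionOf hsym hd)).1
  have hrange : ∀ (T : kerMinus H →L[ℂ] kerPlus H) (w : E), ∃ x,
      (x, ħ⁻¹ • (x - w)) ∈ (evolutionOperator ħ (extensionOf H T)).graph := by
    intro T w
    obtain ⟨a, b, hab, m, rfl⟩ := hsym.exists_decomposition hd w
    exact ⟨_, mem_graph_evolutionOperator_extensionOf hsym hd hab m⟩
  have hmax : ∀ T : kerMinus H →L[ℂ] kerPlus H, ‖T‖ ≤ 1 →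
      IsMaximallyDissipative (evolutionOperator ħ (extensionOf H T)) := fun T hT =>
    (isDissipative_extensionOf hsym hd hT hħ).isMaximallyDissipative hc (hrange T)
  choose R hR hRB using fun T : {T : kerMinus H →L[ℂ] kerPlus H // ‖T‖ ≤ 1} =>
    (isDissipative_extensionOf hsym hd T.2 hħ).exists_resolvent hc (hdense T) (hrange T)
  choose V hV using fun T => (hR T).exists_semigroup
  have hgen : ∀ T, ((V T).rescale c).IsGeneratedBy (evolutionOperator ħ (extensionOf H T)) :=
    fun T => (hV T).isGeneratedBy (hR T) (c := c) hc (hRB T)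
  refine ⟨fun T hT => ⟨evolutionOperator_mono (le_extensionOf hsym hd), hdense T, hmax T hT,
    (V ⟨T, hT⟩).rescale c, hgen ⟨T, hT⟩, fun U hU => hU.unique (hgen ⟨T, hT⟩) (hdense T)⟩, ?_⟩
  intro T T₀ U hT hU hT₀ hlim
  refine ⟨(V ⟨T₀, hT₀⟩).rescale c, fun t x => ?_, hgen ⟨T₀, hT₀⟩, hmax T₀ hT₀⟩
  classical
  -- `T ε` is known to be a contraction only for `ε > 0`. The value `T₀` elsewhere makes the family
  -- total and is invisible to `𝓝[>] 0`.
  let S : ℝ → {T : kerMinus H →L[ℂ] kerPlus H // ‖T‖ ≤ 1} := fun ε =>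
    if h : 0 < ε then ⟨T ε, hT ε h⟩ else ⟨T₀, hT₀⟩
  have hS : ∀ ε, 0 < ε → (S ε : kerMinus H →L[ℂ] kerPlus H) = T ε := fun ε h => by simp [S, h]
  have hRlim : ∀ w, Tendsto (fun ε => R (S ε) w) (𝓝[>] 0) (𝓝 (R ⟨T₀, hT₀⟩ w)) := by
    intro w
    obtain ⟨a, b, hab, m, rfl⟩ := hsym.exists_decomposition hd w
    -- One decomposition of `w` serves all `T`, so the resolvents differ only in the term `T m`.
    have h1 : ∀ T, R T (a + Complex.I • b + (2 : ℂ) • (m : E)) = a + (T.1 m : E) + m := fun T =>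
      (hRB T).apply_eq hc.ne' (mem_graph_evolutionOperator_extensionOf hsym hd hab m)
    simp only [h1]
    have h2 : Tendsto (fun ε => ((S ε).1 m : E)) (𝓝[>] 0) (𝓝 (T₀ m : E)) := by
      refine ((continuous_subtype_val.tendsto _).comp (hlim m)).congr' ?_
      exact eventually_nhdsWithin_of_forall fun ε hε => by simp only [Function.comp, hS ε hε]
    exact (h2.const_add a).add_const _
  refine (IsFirmResolvent.IsApproxLimit.tendsto_op (fun ε => hV (S ε)) (hV ⟨T₀, hT₀⟩)
    (fun ε => hR (S ε)) (hR ⟨T₀, hT₀⟩) hRlim (c * t) x).congr' ?_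
  refine eventually_nhdsWithin_of_forall fun ε hε => ?_
  -- The given semigroup is identified with the constructed one by uniqueness of the semigroup of a
  -- densely defined generator.
  have h1 : U ε = (V (S ε)).rescale c :=
    (hU ε hε).unique (by rw [← hS ε hε]; exact hgen (S ε)) (hdense (T ε))
  simp only [h1]
  rfl
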